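/- Let $\mathcal{C}$ be an additive category with a (Quillen) exact structure $\mathcal{E}$, i.e. an isomorphism-closed class of kernel–cokernel pairs $A\rightarrowtail B\twoheadrightarrow C$ satisfying the six usual axioms. An object $P$ is $\mathcal{E}$-projective if $\mathrm{Hom}(P,-)$ takes $\mathcal{E}$-exact sequences to short exact sequences; $\mathcal{P}(\mathcal{E})$ is the class of these objects. Assume that $(\mathcal{C},\mathcal{E})$ is a strong exact IT-context, that is: - $\mathcal{C}$ is skeletally small; - $\mathcal{C}$ is Krull–Schmidt: each object is a finite direct sum of objects with local endomorphism rings; - there are enough $\mathcal{E}$-projectives: for each $M$ there is an $\mathcal{E}$-exact sequence $\Omega M\rightarrowtail P\twoheadrightarrow M$ with $P\in\mathcal{P}(\mathcal{E})$ (one such sequence is fixed for each $M$, and $\Omega^0M=M$, $\Omega^{n+1}M=\Omega(\Omega^nM)$); - $\mathcal{C}$ has the Fitting property: for each endomorphism $f$ of an object $X$ there is a decomposition $X=Y\oplus Z$ with respect to which $f=\begin{pmatrix}\varphi&0\\0&\alpha\end{pmatrix}$, with $\varphi$ an automorphism of $Y$ and $\alpha$ a nilpotent endomorphism of $Z$.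 Let $\mathrm{Ext}^n_{\mathcal{E}}(M,N)=H^n(\mathrm{Hom}(P_\bullet,N))$ for an $\mathcal{E}$-projective resolution $P_\bullet$ of $M$, and let $\mathrm{pd}_{\mathcal{E}}(M)\in\mathbb{N}\cup\{\infty\}$ be the least $n\in\mathbb{N}$ such that $\mathrm{Ext}^j_{\mathcal{E}}(M,N)=0$ for all $j>n$ and all $N$. For a class $\mathcal{Y}$ of objects, $\mathrm{fpd}_{\mathcal{E}}(\mathcal{Y})$ is the supremum of the finite values $\mathrm{pd}_{\mathcal{E}}(Y)$, $Y\in\mathcal{Y}$; and $\mathrm{add}(M)$ is the class of direct summands of finite direct sums of copies of $M$. Let $K_{\mathcal{E}}(\mathcal{C})$ be the free abelian group on the isomorphism classes $[M]$ of objects modulo the relations $[N]=[S]+[T]$ for $N\cong S\oplus T$ and $[P]=0$ for $P\in\mathcal{P}(\mathcal{E})$. The rule $[M]\mapsto[\Omega M]$ defines an endomorphism $\Omega$ of $K_{\mathcal{E}}(\mathcal{C})$. Let $\langle M\rangle\subseteq K_{\mathcal{E}}(\mathcal{C})$ be the subgroup generated by the indecomposable direct summands of $M$ in the stable category $\mathcal{C}/\mathcal{P}(\mathcal{E})$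 (same objects, morphisms modulo those that factor through an $\mathcal{E}$-projective object). Put $$\Phi_{\mathcal{E}}(M)=\min\{k\in\mathbb{N}:\ \Omega\colon\Omega^m\langle M\rangle\to\Omega^{m+1}\langle M\rangle\text{ is bijective for all }m\ge k\},$$ $$\Psi_{\mathcal{E}}(M)=\Phi_{\mathcal{E}}(M)+\mathrm{fpd}_{\mathcal{E}}\bigl(\mathrm{add}(\Omega^{\Phi_{\mathcal{E}}(M)}M)\bigr),$$ both of which are natural numbers. Then for every $\mathcal{E}$-exact sequence $A\rightarrowtail B\twoheadrightarrow C$ with $\mathrm{pd}_{\mathcal{E}}(C)<\infty$, $$\mathrm{pd}_{\mathcal{E}}(C)\le\Psi_{\mathcal{E}}(A\oplus B)+1.$$ -/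

import Mathlib

open CategoryTheory CategoryTheory.Limits

universe v u

attribute [local instance] hasBinaryBiproducts_of_finite_biproducts

/-- A (Quillen) exact structure on an additive category: an isomorphism-closed class `exact` of
kernel-cokernel pairs `X₁ ⟶ X₂ ⟶ X₃` satisfying the six usual axioms.  An arrow is an admissible
monic (epic) when it is the first (second) arrow of a pair in the class. -/
structure ExactStructure (C : Type u) [Category.{v} C] [Preadditive C] where
  /-- the class of short exact sequences -/
  exact : ShortComplex C → Prop
  /-- in a short exact sequence, the first arrow is a kernel of the second one -/
  isKernel : ∀ S : ShortComplex C, exact S → Nonempty (IsLimit (KernelFork.ofι S.f S.zero))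
  /-- in a short exact sequence, the second arrow is a cokernel of the first one -/
  isCokernel : ∀ S : ShortComplex C, exact S →
    Nonempty (IsColimit (CokernelCofork.ofπ S.g S.zero))
  /-- closure under isomorphisms -/
  of_iso : ∀ S T : ShortComplex C, (S ≅ T) → exact S → exact T
  /-- identities are admissible monics -/
  id_mono : ∀ A : C, ∃ (Z : C) (p : A ⟶ Z) (w : 𝟙 A ≫ p = 0), exact (ShortComplex.mk (𝟙 A) p w)
  /-- identities are admissible epics -/
  id_epi : ∀ A : C, ∃ (K : C) (i : K ⟶ A) (w : i ≫ 𝟙 A = 0), exact (ShortComplex.mk i (𝟙 A) w)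
  /-- admissible monics are closed under composition -/
  comp_mono : ∀ {A B D : C} (i : A ⟶ B) (j : B ⟶ D),
    (∃ (Z : C) (p : B ⟶ Z) (w : i ≫ p = 0), exact (ShortComplex.mk i p w)) →
    (∃ (Z : C) (p : D ⟶ Z) (w : j ≫ p = 0), exact (ShortComplex.mk j p w)) →
    ∃ (Z : C) (p : D ⟶ Z) (w : (i ≫ j) ≫ p = 0), exact (ShortComplex.mk (i ≫ j) p w)
  /-- admissible epics are closed under composition -/
  comp_epi : ∀ {A B D : C} (p : A ⟶ B) (q : B ⟶ D),
    (∃ (K : C) (i : K ⟶ A) (w : i ≫ p = 0), exact (ShortComplex.mk i p w)) →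
    (∃ (K : C) (i : K ⟶ B) (w : i ≫ q = 0), exact (ShortComplex.mk i q w)) →
    ∃ (K : C) (i : K ⟶ A) (w : i ≫ (p ≫ q) = 0), exact (ShortComplex.mk i (p ≫ q) w)
  /-- the push-out of an admissible monic along any arrow exists and is an admissible monic -/
  pushout : ∀ {A B A' : C} (i : A ⟶ B) (f : A ⟶ A'),
    (∃ (Z : C) (p : B ⟶ Z) (w : i ≫ p = 0), exact (ShortComplex.mk i p w)) →
    ∃ (B' : C) (f' : B ⟶ B') (i' : A' ⟶ B'), IsPushout i f f' i' ∧
      ∃ (Z : C) (p : B' ⟶ Z) (w : i' ≫ p = 0), exact (ShortComplex.mk i' p w)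
  /-- the pull-back of an admissible epic along any arrow exists and is an admissible epic -/
  pullback : ∀ {B D D' : C} (p : B ⟶ D) (f : D' ⟶ D),
    (∃ (K : C) (i : K ⟶ B) (w : i ≫ p = 0), exact (ShortComplex.mk i p w)) →
    ∃ (B' : C) (f' : B' ⟶ B) (p' : B' ⟶ D'), IsPullback f' p' p f ∧
      ∃ (K : C) (i : K ⟶ B') (w : i ≫ p' = 0), exact (ShortComplex.mk i p' w)

namespace ExactStructure

section Basic

variable {C : Type u} [Category.{v} C] [Preadditive C] (E : ExactStructure C)

/-- Second arrows of short exact sequences. -/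
def AdmissibleEpi {B D : C} (p : B ⟶ D) : Prop :=
  ∃ (K : C) (i : K ⟶ B) (w : i ≫ p = 0), E.exact (ShortComplex.mk i p w)

/-- `P` is `E`-projective: `Hom(P, -)` carries short `E`-exact sequences to short exact sequences.
As `Hom(P, -)` is left exact on kernel-cokernel pairs, this is surjectivity of
`Hom(P, X₂) → Hom(P, X₃)`. -/
def IsProjective (P : C) : Prop :=
  ∀ S : ShortComplex C, E.exact S → ∀ f : P ⟶ S.X₃, ∃ g : P ⟶ S.X₂, g ≫ S.g = f

/-- `K` is an `E`-syzygy of `M`: there is a short `E`-exact sequence `K ⟶ P ⟶ M` with `P`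
`E`-projective. -/
def IsSyzygy (K M : C) : Prop :=
  ∃ (P : C) (i : K ⟶ P) (p : P ⟶ M) (w : i ≫ p = 0),
    E.exact (ShortComplex.mk i p w) ∧ E.IsProjective P

/-- There are enough `E`-projectives. -/
class EnoughProjectives : Prop where
  exists_syzygy : ∀ M : C, ∃ K : C, E.IsSyzygy K M

end Basic

section Preliminaries

variable {C : Type u} [Category.{v} C] [Preadditive C]
  {E : ExactStructure C}

lemma IsProjective.lift {P : C} (hP : E.IsProjective P) {K B D : C} {i : K ⟶ B} {p : B ⟶ D}
    {w : i ≫ p = 0} (h : E.exact (ShortComplex.mk i p w)) (f : P ⟶ D) :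
    ∃ g : P ⟶ B, g ≫ p = f :=
  hP _ h f

lemma IsProjective.of_retract {P Q : C} (hP : E.IsProjective P) (s : Q ⟶ P) (r : P ⟶ Q)
    (h : s ≫ r = 𝟙 Q) : E.IsProjective Q := by
  intro S hS f
  obtain ⟨g, hg⟩ := hP S hS (r ≫ f)
  exact ⟨s ≫ g, by rw [Category.assoc, hg, reassoc_of% h]⟩

lemma mono_of_exact {K B D : C} {i : K ⟶ B} {p : B ⟶ D} {w : i ≫ p = 0}
    (h : E.exact (ShortComplex.mk i p w)) {X : C} (f g : X ⟶ K) (hfg : f ≫ i = g ≫ i) :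
    f = g := by
  obtain ⟨l⟩ := E.isKernel _ h
  exact Fork.IsLimit.hom_ext l hfg

lemma exists_lift_of_exact {K B D : C} {i : K ⟶ B} {p : B ⟶ D} {w : i ≫ p = 0}
    (h : E.exact (ShortComplex.mk i p w)) {X : C} (f : X ⟶ B) (hf : f ≫ p = 0) :
    ∃ g : X ⟶ K, g ≫ i = f := by
  obtain ⟨l⟩ := E.isKernel _ h
  exact ⟨l.lift (KernelFork.ofι f hf), l.fac _ WalkingParallelPair.zero⟩

/-- An admissible epic together with any of its kernels is a short exact sequence. -/
lemma AdmissibleEpi.exact_of_isKernel {K B D : C} {i : K ⟶ B} {p : B ⟶ D}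
    (hp : E.AdmissibleEpi p) (w : i ≫ p = 0) (hi : ∀ {X : C} (f g : X ⟶ K), f ≫ i = g ≫ i → f = g)
    (hl : ∀ {X : C} (f : X ⟶ B), f ≫ p = 0 → ∃ g : X ⟶ K, g ≫ i = f) :
    E.exact (ShortComplex.mk i p w) := by
  obtain ⟨K', i', w', h⟩ := hp
  obtain ⟨a, ha⟩ := exists_lift_of_exact h i w
  obtain ⟨b, hb⟩ := hl i' w'
  have hab : a ≫ b = 𝟙 K := hi _ _ (by simp [hb, ha])
  have hba : b ≫ a = 𝟙 K' := mono_of_exact h _ _ (by simp [hb, ha])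
  have e : ShortComplex.mk i' p w' ≅ ShortComplex.mk i p w :=
    ShortComplex.isoMk ⟨b, a, hba, hab⟩ (Iso.refl _) (Iso.refl _) (by simp [hb]) (by simp)
  exact E.of_iso _ _ e h

/-- Admissible epics are stable under all pull-backs. -/
lemma AdmissibleEpi.of_isPullback {B D B' D' : C} {f' : B' ⟶ B} {p' : B' ⟶ D'} {p : B ⟶ D}
    {f : D' ⟶ D} (hp : E.AdmissibleEpi p) (sq : IsPullback f' p' p f) : E.AdmissibleEpi p' := by
  obtain ⟨X, g', q, sq', K, i, w, h⟩ := E.pullback p f hp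
  let e : X ≅ B' := sq'.isoIsPullback _ _ sq
  have he : e.hom ≫ p' = q := sq'.isoIsPullback_hom_snd _ _ sq
  have w' : (i ≫ e.hom) ≫ p' = 0 := by rw [Category.assoc, he, w]
  have e' : ShortComplex.mk i q w ≅ ShortComplex.mk (i ≫ e.hom) p' w' :=
    ShortComplex.isoMk (Iso.refl _) e (Iso.refl _) (by simp) (by simp [he])
  exact ⟨K, i ≫ e.hom, w', E.of_iso _ _ e' h⟩

lemma IsSyzygy.of_iso {K M M' : C} (h : E.IsSyzygy K M) (e : M ≅ M') : E.IsSyzygy K M' := by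
  obtain ⟨P, i, p, w, h, hP⟩ := h
  have w' : i ≫ p ≫ e.hom = 0 := by simp [reassoc_of% w]
  have e' : ShortComplex.mk i p w ≅ ShortComplex.mk i (p ≫ e.hom) w' :=
    ShortComplex.isoMk (Iso.refl _) (Iso.refl _) e (by simp) (by simp)
  exact ⟨P, i, p ≫ e.hom, w', E.of_iso _ _ e' h, hP⟩

/-- A syzygy of a projective object is projective. -/
lemma IsSyzygy.isProjective {K M : C} (h : E.IsSyzygy K M) (hM : E.IsProjective M) :
    E.IsProjective K := by
  obtain ⟨P, i, p, w, h, hP⟩ := h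
  obtain ⟨s, hs⟩ := hM.lift h (𝟙 M)
  obtain ⟨r, hr⟩ := exists_lift_of_exact h (𝟙 P - p ≫ s) (by simp [hs])
  exact hP.of_retract i r (mono_of_exact h _ _ (by simp [hr, reassoc_of% w]))

variable [HasFiniteBiproducts C]

lemma IsProjective.biprod {P Q : C} (hP : E.IsProjective P) (hQ : E.IsProjective Q) :
    E.IsProjective (P ⊞ Q) := by
  intro S hS f
  obtain ⟨g, hg⟩ := hP S hS (biprod.inl ≫ f)
  obtain ⟨g', hg'⟩ := hQ S hS (biprod.inr ≫ f)
  refine ⟨biprod.desc g g', ?_⟩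
  apply biprod.hom_ext' <;> simp [hg, hg']

/-- The biproduct of two short exact sequences is short exact. -/
lemma exact_biprod {K B D K' B' D' : C} {i : K ⟶ B} {p : B ⟶ D} {w : i ≫ p = 0}
    {i' : K' ⟶ B'} {p' : B' ⟶ D'} {w' : i' ≫ p' = 0}
    (h : E.exact (ShortComplex.mk i p w)) (h' : E.exact (ShortComplex.mk i' p' w')) :
    E.exact (ShortComplex.mk (biprod.map i i') (biprod.map p p')
      (by apply biprod.hom_ext' <;> simp [reassoc_of% w, reassoc_of% w'])) := by
  have h1 : E.AdmissibleEpi (biprod.map p (𝟙 B')) := by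
    refine AdmissibleEpi.of_isPullback (f' := biprod.fst) (p := p) (f := biprod.fst)
      ⟨K, i, w, h⟩ ⟨⟨by simp⟩, ⟨PullbackCone.IsLimit.mk _
        (fun s => biprod.lift s.fst (s.snd ≫ biprod.snd)) (by simp) ?_ ?_⟩⟩
    · intro s
      apply biprod.hom_ext
      · simpa using s.condition
      · simp
    · intro s m hm hm'
      apply biprod.hom_ext
      · simpa using hm
      · simp [← hm']
  have h2 : E.AdmissibleEpi (biprod.map (𝟙 D) p') := by
    refine AdmissibleEpi.of_isPullback (f' := biprod.snd) (p := p') (f := biprod.snd)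
      ⟨K', i', w', h'⟩ ⟨⟨by simp⟩, ⟨PullbackCone.IsLimit.mk _
        (fun s => biprod.lift (s.snd ≫ biprod.fst) s.fst) (by simp) ?_ ?_⟩⟩
    · intro s
      apply biprod.hom_ext
      · simp
      · simpa using s.condition
    · intro s m hm hm'
      apply biprod.hom_ext
      · simp [← hm']
      · simpa using hm
  have h3 : E.AdmissibleEpi (biprod.map p p') := by
    have := E.comp_epi _ _ h1 h2
    have e : biprod.map p (𝟙 B') ≫ biprod.map (𝟙 D) p' = biprod.map p p' := by
      apply biprod.hom_ext' <;> simp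
    rw [e] at this
    exact this
  refine h3.exact_of_isKernel _ ?_ ?_
  · intro X f g hfg
    apply biprod.hom_ext
    · exact mono_of_exact h _ _ (by simpa using hfg =≫ biprod.fst)
    · exact mono_of_exact h' _ _ (by simpa using hfg =≫ biprod.snd)
  · intro X f hf
    obtain ⟨a, ha⟩ := exists_lift_of_exact h (f ≫ biprod.fst) (by simpa using hf =≫ biprod.fst)
    obtain ⟨b, hb⟩ := exists_lift_of_exact h' (f ≫ biprod.snd) (by simpa using hf =≫ biprod.snd)
    exact ⟨biprod.lift a b, by apply biprod.hom_ext <;> simp [ha, hb]⟩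

lemma IsSyzygy.biprod {K M K' M' : C} (h : E.IsSyzygy K M) (h' : E.IsSyzygy K' M') :
    E.IsSyzygy (K ⊞ K') (M ⊞ M') := by
  obtain ⟨P, i, p, w, h, hP⟩ := h
  obtain ⟨P', i', p', w', h', hP'⟩ := h'
  exact ⟨P ⊞ P', _, _, _, exact_biprod h h', hP.biprod hP'⟩

lemma nonempty_iso_of_isPullback {K P M X Q : C} {i : K ⟶ P} {p : P ⟶ M} {w : i ≫ p = 0}
    (h : E.exact (ShortComplex.mk i p w)) (hQ : E.IsProjective Q) {q : Q ⟶ M} {a : X ⟶ P}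
    {b : X ⟶ Q} (sq : IsPullback a b p q) : Nonempty (X ≅ K ⊞ Q) := by
  obtain ⟨t, ht⟩ := hQ.lift h q
  let s : Q ⟶ X := sq.lift t (𝟙 Q) (by simp [ht])
  have hsa : s ≫ a = t := sq.lift_fst _ _ _
  have hsb : s ≫ b = 𝟙 Q := sq.lift_snd _ _ _
  let k : K ⟶ X := sq.lift i 0 (by simp [w])
  have hka : k ≫ a = i := sq.lift_fst _ _ _
  have hkb : k ≫ b = 0 := sq.lift_snd _ _ _
  obtain ⟨r, hr⟩ := exists_lift_of_exact h (a - b ≫ t) (by simp [ht, sq.w])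
  have hkr : k ≫ r = 𝟙 K := mono_of_exact h _ _ (by simp [hr, hka, reassoc_of% hkb])
  have hsr : s ≫ r = 0 := mono_of_exact h _ _ (by simp [hr, hsa, reassoc_of% hsb])
  refine ⟨⟨biprod.lift r b, biprod.desc k s, ?_, ?_⟩⟩
  · apply sq.hom_ext
    · simp [hka, hsa, hr]
    · simp [hkb, hsb]
  · apply biprod.hom_ext' <;> apply biprod.hom_ext <;> simp [hkr, hkb, hsr, hsb]

/-- Schanuel's lemma. -/
lemma IsSyzygy.schanuel {K K' M : C} (h : E.IsSyzygy K M) (h' : E.IsSyzygy K' M) :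
    ∃ P P' : C, E.IsProjective P ∧ E.IsProjective P' ∧ Nonempty (K ⊞ P' ≅ K' ⊞ P) := by
  obtain ⟨P, i, p, w, h, hP⟩ := h
  obtain ⟨P', i', p', w', h', hP'⟩ := h'
  obtain ⟨X, a, b, sq, -⟩ := E.pullback p p' ⟨K, i, w, h⟩
  obtain ⟨e⟩ := nonempty_iso_of_isPullback h hP' sq
  obtain ⟨e'⟩ := nonempty_iso_of_isPullback h' hP sq.flip
  exact ⟨P, P', hP, hP', ⟨e.symm ≪≫ e'⟩⟩

end Preliminaries

noncomputable section

/-! ### Chosen syzygies, projective resolutions, relative Ext groups and projective dimension -/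

section Homology

variable {C : Type u} [Category.{v} C] [Preadditive C]
  (E : ExactStructure C) [E.EnoughProjectives]

/-- The chosen `E`-syzygy `Ω M`. -/
def syzygy (M : C) : C := (EnoughProjectives.exists_syzygy (E := E) M).choose

lemma isSyzygy_syzygy (M : C) : E.IsSyzygy (E.syzygy M) M :=
  (EnoughProjectives.exists_syzygy (E := E) M).choose_spec

/-- The iterated syzygies `Ωⁿ M`. -/
def iteratedSyzygy (M : C) : ℕ → C
  | 0 => M
  | n + 1 => E.syzygy (iteratedSyzygy M n)

/-- An `E`-projective resolution `⋯ ⟶ P 1 ⟶ P 0 ⟶ M`: an `E`-acyclic complex cut into its short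
`E`-exact sequences `Z (n + 1) ⟶ P n ⟶ Z n`, where `Z 0 ≅ M`. -/
structure ProjectiveResolution (M : C) where
  /-- the projective terms -/
  P : ℕ → C
  /-- the cycle objects -/
  Z : ℕ → C
  /-- the inclusions of the cycles -/
  ι : ∀ n, Z (n + 1) ⟶ P n
  /-- the projections onto the cycles -/
  π : ∀ n, P n ⟶ Z n
  w : ∀ n, ι n ≫ π n = 0
  exact : ∀ n, E.exact (ShortComplex.mk (ι n) (π n) (w n))
  projective : ∀ n, E.IsProjective (P n)
  /-- the resolution augments to `M` -/
  augmentation : Z 0 ≅ M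

namespace ProjectiveResolution

variable {E} {M : C} (R : ProjectiveResolution E M)

/-- The differential `P (n + 1) ⟶ P n` of the resolution. -/
def d (n : ℕ) : R.P (n + 1) ⟶ R.P n := R.π (n + 1) ≫ R.ι n

/-- The map `Hom(P n, B) ⟶ Hom(P (n + 1), B)` given by precomposition with the differential. -/
def coboundaryMap (B : C) (n : ℕ) : (R.P n ⟶ B) →+ (R.P (n + 1) ⟶ B) :=
  Preadditive.leftComp B (R.d n)

/-- The `n`-cocycles of the complex `Hom(P, B)`. -/
def cocycles (B : C) (n : ℕ) : AddSubgroup (R.P n ⟶ B) := (R.coboundaryMap B n).ker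

/-- The `n`-coboundaries of the complex `Hom(P, B)`. -/
def coboundaries (B : C) : ∀ n : ℕ, AddSubgroup (R.P n ⟶ B)
  | 0 => ⊥
  | n + 1 => (R.coboundaryMap B n).range

/-- The cohomology group `Hⁿ(Hom(P, B))`. -/
abbrev cohomology (B : C) (n : ℕ) : Type v :=
  R.cocycles B n ⧸ (R.coboundaries B n).addSubgroupOf (R.cocycles B n)

end ProjectiveResolution

/-- The chosen `E`-projective resolution, obtained by iterating the chosen syzygies. -/
def projectiveResolution (M : C) : ProjectiveResolution E M where
  P n := (E.isSyzygy_syzygy (E.iteratedSyzygy M n)).choose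
  Z n := E.iteratedSyzygy M n
  ι n := (E.isSyzygy_syzygy (E.iteratedSyzygy M n)).choose_spec.choose
  π n := (E.isSyzygy_syzygy (E.iteratedSyzygy M n)).choose_spec.choose_spec.choose
  w n := (E.isSyzygy_syzygy (E.iteratedSyzygy M n)).choose_spec.choose_spec.choose_spec.choose
  exact n :=
    (E.isSyzygy_syzygy (E.iteratedSyzygy M n)).choose_spec.choose_spec.choose_spec.choose_spec.1
  projective n :=
    (E.isSyzygy_syzygy (E.iteratedSyzygy M n)).choose_spec.choose_spec.choose_spec.choose_spec.2
  augmentation := Iso.refl M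

/-- The `E`-relative extension group `Extⁿ(M, B) = Hⁿ(Hom(P, B))`, for the chosen projective
resolution `P` of `M`. -/
abbrev Ext (n : ℕ) (M B : C) : Type v := (E.projectiveResolution M).cohomology B n

/-- The `E`-projective dimension: the least `n` with `Extʲ(M, B) = 0` for all `j > n` and all
objects `B`, and `⊤` if there is none. -/
def pd (M : C) : ℕ∞ :=
  ⨅ (n : ℕ) (_ : ∀ j : ℕ, n < j → ∀ B : C, Subsingleton (E.Ext j M B)), (n : ℕ∞)

/-- The finitistic `E`-projective dimension of a class of objects: the supremum of the
projective dimensions of its objects of finite projective dimension. -/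
def fpd (Y : Set C) : ℕ∞ := ⨆ M ∈ {M : C | M ∈ Y ∧ E.pd M < ⊤}, E.pd M

end Homology

/-- `add M`: the direct summands of finite direct sums of copies of `M`. -/
def addClosure {C : Type u} [Category.{v} C] [Preadditive C] [HasFiniteBiproducts C] (M : C) :
    Set C :=
  {X | ∃ (k : ℕ) (Y : C), Nonempty ((X ⊞ Y) ≅ ⨁ (fun _ : Fin k => M))}

/-! ### The stable category -/

section Stable

variable {C : Type u} [Category.{v} C] [Preadditive C] [HasFiniteBiproducts C]
  (E : ExactStructure C)

/-- Two arrows are identified when their difference factors through an `E`-projective object. -/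
def stableRel : HomRel C := fun X Y f g =>
  ∃ (P : C) (a : X ⟶ P) (b : P ⟶ Y), E.IsProjective P ∧ f - g = a ≫ b

lemma exists_isProjective : ∃ P : C, E.IsProjective P :=
  ⟨⨁ (fun i : Fin 0 => i.elim0), fun _ _ _ => ⟨0, biproduct.hom_ext' _ _ fun i => i.elim0⟩⟩

lemma stableRel_add ⦃X Y : C⦄ (f₁ f₂ g₁ g₂ : X ⟶ Y) (hf : E.stableRel f₁ f₂)
    (hg : E.stableRel g₁ g₂) : E.stableRel (f₁ + g₁) (f₂ + g₂) := by
  obtain ⟨P, a, b, hP, e⟩ := hf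
  obtain ⟨P', a', b', hP', e'⟩ := hg
  refine ⟨P ⊞ P', biprod.lift a a', biprod.desc b b', hP.biprod hP', ?_⟩
  rw [biprod.lift_desc, ← e, ← e']
  abel

instance : Congruence E.stableRel where
  comp_left f g g' := by
    rintro ⟨P, a, b, hP, e⟩
    exact ⟨P, f ≫ a, b, hP, by rw [← Preadditive.comp_sub, e, Category.assoc]⟩
  comp_right g := by
    rintro ⟨P, a, b, hP, e⟩
    exact ⟨P, a, b ≫ g, hP, by rw [← Preadditive.sub_comp, e, Category.assoc]⟩
  equivalence := by
    intro X Y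
    refine ⟨fun f => ?_, fun {f g} => ?_, fun {f g h} hfg hgh => ?_⟩
    · obtain ⟨P, hP⟩ := E.exists_isProjective
      exact ⟨P, 0, 0, hP, by simp⟩
    · rintro ⟨P, a, b, hP, e⟩
      exact ⟨P, -a, b, hP, by rw [Preadditive.neg_comp, ← e, neg_sub]⟩
    · obtain ⟨P, a, b, hP, e⟩ := hfg
      obtain ⟨P', a', b', hP', e'⟩ := hgh
      exact ⟨P ⊞ P', biprod.lift a a', biprod.desc b b', hP.biprod hP', by
        rw [biprod.lift_desc, ← e, ← e', sub_add_sub_cancel]⟩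

/-- The stable category: same objects, arrows modulo those factoring through an
`E`-projective object. -/
abbrev StableCategory := CategoryTheory.Quotient E.stableRel

instance : Preadditive E.StableCategory :=
  CategoryTheory.Quotient.preadditive E.stableRel E.stableRel_add

/-- The canonical functor to the stable category. -/
abbrev toStable : C ⥤ E.StableCategory := CategoryTheory.Quotient.functor E.stableRel

instance : E.toStable.Additive :=
  CategoryTheory.Quotient.functor_additive E.stableRel E.stableRel_add

instance : HasBinaryBiproducts E.StableCategory where
  has_binary_biproduct X Y := by
    have := preservesBinaryBiproducts_of_preservesBiproducts E.toStable
    exact inferInstanceAs (HasBinaryBiproduct (E.toStable.obj X.as) (E.toStable.obj Y.as))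

end Stable

/-! ### The group `K` and the syzygy endomorphism -/

section KGroup

variable {C : Type u} [Category.{v} C] [Preadditive C] [HasFiniteBiproducts C]
  (E : ExactStructure C)

/-- The generator of the free abelian group on isomorphism classes attached to an object. -/
def isoClass (M : C) : FreeAbelianGroup (_root_.Quotient (isIsomorphicSetoid C)) :=
  FreeAbelianGroup.of (_root_.Quotient.mk (isIsomorphicSetoid C) M)

/-- The relations `[N] - [S] - [T]` for `N ≅ S ⊕ T`, and `[P]` for `P` projective. -/
def kRelations : Set (FreeAbelianGroup (_root_.Quotient (isIsomorphicSetoid C))) :=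
  {x | ∃ N S T : C, Nonempty (N ≅ S ⊞ T) ∧ x = isoClass N - isoClass S - isoClass T} ∪
  {x | ∃ P : C, E.IsProjective P ∧ x = isoClass P}

/-- The group `K`: the free abelian group on isomorphism classes of objects modulo the
relations. -/
abbrev K : Type u :=
  FreeAbelianGroup (_root_.Quotient (isIsomorphicSetoid C)) ⧸ AddSubgroup.closure E.kRelations

/-- The class `[M]` in `K`. -/
def cls (M : C) : E.K := QuotientAddGroup.mk (isoClass M)

variable {E}

lemma cls_eq_of_iso {M N : C} (e : M ≅ N) : E.cls M = E.cls N := by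
  have : isoClass M = isoClass N := congrArg FreeAbelianGroup.of (_root_.Quotient.sound ⟨e⟩)
  rw [cls, cls, this]

lemma cls_of_isProjective {P : C} (hP : E.IsProjective P) : E.cls P = 0 :=
  (QuotientAddGroup.eq_zero_iff _).2 (AddSubgroup.subset_closure (Or.inr ⟨P, hP, rfl⟩))

lemma cls_biprod (M N : C) : E.cls (M ⊞ N) = E.cls M + E.cls N := by
  have h : (QuotientAddGroup.mk (isoClass (M ⊞ N) - isoClass M - isoClass N) : E.K) = 0 :=
    (QuotientAddGroup.eq_zero_iff _).2
      (AddSubgroup.subset_closure (Or.inl ⟨_, M, N, ⟨Iso.refl _⟩, rfl⟩))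
  have h' : E.cls (M ⊞ N) - E.cls M - E.cls N = 0 := h
  rw [sub_sub] at h'
  exact sub_eq_zero.1 h'

lemma IsSyzygy.cls_eq {K K' M : C} (h : E.IsSyzygy K M) (h' : E.IsSyzygy K' M) :
    E.cls K = E.cls K' := by
  obtain ⟨P, P', hP, hP', ⟨e⟩⟩ := h.schanuel h'
  simpa [cls_biprod, cls_of_isProjective hP, cls_of_isProjective hP'] using
    cls_eq_of_iso (E := E) e

variable (E) [E.EnoughProjectives]

/-- The homomorphism on the free abelian group given by `[M] ↦ [Ω M]`. -/
def omegaAux : FreeAbelianGroup (_root_.Quotient (isIsomorphicSetoid C)) →+ E.K :=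
  FreeAbelianGroup.lift (_root_.Quotient.lift (fun M : C => E.cls (E.syzygy M)) (by
    rintro M N ⟨e⟩
    exact ((E.isSyzygy_syzygy M).of_iso e).cls_eq (E.isSyzygy_syzygy N)))

lemma omegaAux_isoClass (M : C) : E.omegaAux (isoClass M) = E.cls (E.syzygy M) :=
  FreeAbelianGroup.lift_apply_of _ _

lemma closure_le_ker_omegaAux : AddSubgroup.closure E.kRelations ≤ E.omegaAux.ker := by
  rw [AddSubgroup.closure_le]
  rintro x (⟨N, S, T, ⟨e⟩, rfl⟩ | ⟨P, hP, rfl⟩)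
  · have h := ((E.isSyzygy_syzygy N).of_iso e).cls_eq
      ((E.isSyzygy_syzygy S).biprod (E.isSyzygy_syzygy T))
    rw [cls_biprod] at h
    simp [AddMonoidHom.mem_ker, omegaAux_isoClass, h]
  · simpa [AddMonoidHom.mem_ker, omegaAux_isoClass] using
      cls_of_isProjective ((E.isSyzygy_syzygy P).isProjective hP)

/-- The endomorphism `Ω` of `K` with `Ω [M] = [Ω M]`. -/
def omega : E.K →+ E.K :=
  QuotientAddGroup.lift _ E.omegaAux E.closure_le_ker_omegaAux

lemma omega_cls (M : C) : E.omega (E.cls M) = E.cls (E.syzygy M) :=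
  E.omegaAux_isoClass M

end KGroup

/-! ### The Igusa-Todorov functions -/

/-- The least `k` such that `f` restricts to a bijection `f^m(X) → f^(m+1)(X)` for all `m ≥ k`. -/
def fittingIndex {G : Type*} [AddCommGroup G] (f : G →+ G) (X : AddSubgroup G) : ℕ :=
  sInf {k : ℕ | ∀ m : ℕ, k ≤ m →
    Set.BijOn f (f^[m] '' (X : Set G)) (f^[m + 1] '' (X : Set G))}

section IgusaTodorov

variable {C : Type u} [Category.{v} C] [Preadditive C] [HasFiniteBiproducts C]
  (E : ExactStructure C)

/-- The subgroup `⟨M⟩` of `K` generated by the classes of the indecomposable direct summands of `M`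
in the stable category. -/
def summandSubgroup (M : C) : AddSubgroup E.K :=
  AddSubgroup.closure {x | ∃ N : C, Indecomposable (E.toStable.obj N) ∧
    (∃ Y : E.StableCategory, Nonempty (E.toStable.obj M ≅ E.toStable.obj N ⊞ Y)) ∧ x = E.cls N}

variable [E.EnoughProjectives]

/-- The relative Igusa-Todorov function `Φ`. -/
def Phi (M : C) : ℕ := fittingIndex E.omega (E.summandSubgroup M)

/-- The relative Igusa-Todorov function `Ψ`. -/
def Psi (M : C) : ℕ :=
  E.Phi M + (E.fpd (addClosure (E.iteratedSyzygy M (E.Phi M)))).toNat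

end IgusaTodorov

end

end ExactStructure

/-- Krull-Schmidt categories: each object is a finite direct sum of objects with local
endomorphism rings. -/
def IsKrullSchmidt (C : Type u) [Category.{v} C] [Preadditive C] [HasFiniteBiproducts C] : Prop :=
  ∀ X : C, ∃ (n : ℕ) (Y : Fin n → C), Nonempty (X ≅ ⨁ Y) ∧ ∀ i, IsLocalRing (End (Y i))

/-- Fitting's property: each endomorphism is, for a suitable decomposition of the object, the
direct sum of an automorphism and a nilpotent endomorphism. -/
def HasFittingProperty (C : Type u) [Category.{v} C] [Preadditive C] [HasFiniteBiproducts C] :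
    Prop :=
  ∀ (X : C) (f : X ⟶ X), ∃ (Y Z : C) (e : X ≅ Y ⊞ Z) (φ : Y ≅ Y) (α : End Z),
    IsNilpotent α ∧ f = e.hom ≫ biprod.map φ.hom α ≫ e.inv

/-- Strong exact Igusa-Todorov contexts. -/
class ExactStructure.IsStrongITContext {C : Type u} [Category.{v} C] [Preadditive C]
    [HasFiniteBiproducts C] (E : ExactStructure C) : Prop extends E.EnoughProjectives where
  skeletallySmall : EssentiallySmall.{v} C
  krullSchmidt : IsKrullSchmidt C
  fitting : HasFittingProperty C

/-!
Write `φ = Φ(A ⊞ B)` and `N` for the finitistic dimension of `add (Ω^φ (A ⊞ B))`.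

*Projective dimension and the group `K`.* Vanishing of `Ext^(n+1)(M, -)` forces the inclusion of
the syzygy `Ω^(n+1) M` into the resolution to split, so `pd M ≤ n` holds exactly when `Ω^n M`
is projective. In a Krull-Schmidt category direct sums cancel (`IsKrullSchmidt.cancel`), hence the
monoid of stable isomorphism classes embeds into its Grothendieck group, and two objects with the
same class in `K` are stably isomorphic (`stablyIso_of_cls_eq`). Therefore `pd M ≤ n` just says
`Ω^n [M] = 0` (`pd_le_iff`).

*Passing to `Ω^φ`.* If `pd D` is finite, then some power of `Ω` kills `[B] - [A]`, because the
`n`-th syzygies of the sequence form a short exact sequence with projective quotient for large `n`.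
Both classes lie in the finitely generated group `⟨A ⊞ B⟩`, so already `Ω^φ` kills the difference
(`omega_iterate_phi_eq`). Replacing the sequence by its `φ`-th syzygies and adding a split sequence
of projective objects, one may assume that it has the form `X ⟶ X ⊞ R ⟶ D` with `R` projective and
`X` stably a summand of `Ω^φ (A ⊞ B)`.

*Fitting's property.* The component `X ⟶ X` of the first arrow is the sum of an automorphism, which
can be split off, and a nilpotent endomorphism of a summand `Z` of `X`
(`exists_exact_isNilpotent`); this leaves a short exact sequence `Z ⟶ Z ⊞ R ⟶ D`. Nilpotency gives
`pd Z ≤ pd D` (`pd_le_of_isNilpotent`): after passing to syzygies until `D` becomes projective, the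
induced endomorphism of the syzygy of `Z` is both nilpotent and one-sided invertible in the stable
category, so that this syzygy is projective. Hence `pd Z` is finite, and since `Z` is the sum of an
object of `add (Ω^φ (A ⊞ B))` and a projective object, `pd Z ≤ N`. Finally `pd D ≤ pd Z + 1` by the
short exact sequence (`pd_le_succ_of_exact`). Here `N` is a natural number because, by the
Krull-Schmidt property, `add W` has only finitely many indecomposable objects
(`fpd_addClosure_lt_top`).
-/

/-! ### Objects with local endomorphism rings -/

section LocalObjects

variable {C : Type u} [Category.{v} C] [Preadditive C]

/-- If two endomorphisms of an object with local endomorphism ring add up to an automorphism, then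
one of them is an automorphism. -/
lemma isIso_or_isIso_of_add {L : C} (hL : IsLocalRing (End L)) (f g : L ⟶ L)
    [h : IsIso (f + g)] : IsIso f ∨ IsIso g := by
  have hu : IsUnit (M := End L) (HAdd.hAdd (α := End L) (β := End L) f g) :=
    (isUnit_iff_isIso (f + g : L ⟶ L)).2 h
  rcases IsLocalRing.isUnit_or_isUnit_of_isUnit_add hu with h | h
  · exact Or.inl ((isUnit_iff_isIso f).1 h)
  · exact Or.inr ((isUnit_iff_isIso g).1 h)

lemma not_isZero_of_isLocalRing {L : C} (hL : IsLocalRing (End L)) : ¬IsZero L := fun h =>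
  zero_ne_one (α := End L) (h.eq_of_src _ _)

/-- A pair of arrows through `X` whose composite is an automorphism of `L` makes `L` a retract
of `X`. -/
noncomputable def retractOfIsIsoComp {L X : C} (f : L ⟶ X) (g : X ⟶ L) [IsIso (f ≫ g)] :
    Retract L X where
  i := f
  r := g ≫ inv (f ≫ g)
  retract := by rw [← Category.assoc, IsIso.hom_inv_id]

/-- A nonzero retract of an object with local endomorphism ring is the whole object, since a local
ring has no nontrivial idempotents. -/
lemma CategoryTheory.Retract.isIso_of_isLocalRing {L X : C} (h : Retract L X) (hL : ¬IsZero L)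
    (hX : IsLocalRing (End X)) : IsIso h.i := by
  have : IsIso (h.r ≫ h.i + (𝟙 X - h.r ≫ h.i)) := by
    rw [add_sub_cancel]; infer_instance
  rcases isIso_or_isIso_of_add hX (h.r ≫ h.i) (𝟙 X - h.r ≫ h.i) with h1 | h1
  · refine ⟨h.r, h.retract, ?_⟩
    rw [← cancel_epi (h.r ≫ h.i)]
    simp
  · refine absurd ?_ hL
    have h0 : h.r ≫ h.i = 0 := by
      rw [← cancel_epi (𝟙 X - h.r ≫ h.i)]
      simp
    rw [IsZero.iff_id_eq_zero]
    calc 𝟙 L = h.i ≫ (h.r ≫ h.i) ≫ h.r := by simp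
      _ = 0 := by simp [h0]

lemma isIso_of_isIso_comp_of_isLocalRing {L X : C} (hL : IsLocalRing (End L))
    (hX : IsLocalRing (End X)) (f : L ⟶ X) (g : X ⟶ L) [IsIso (f ≫ g)] : IsIso f :=
  (retractOfIsIsoComp f g).isIso_of_isLocalRing (not_isZero_of_isLocalRing hL) hX

lemma comp_biprod_comp [HasBinaryBiproducts C] {X Y A B : C} (f : X ⟶ A ⊞ B) (g : A ⊞ B ⟶ Y) :
    (f ≫ biprod.fst) ≫ (biprod.inl ≫ g) + (f ≫ biprod.snd) ≫ (biprod.inr ≫ g) = f ≫ g := by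
  calc _ = f ≫ (biprod.fst ≫ biprod.inl + biprod.snd ≫ biprod.inr) ≫ g := by
        simp only [Preadditive.add_comp, Preadditive.comp_add, Category.assoc]
    _ = f ≫ g := by rw [biprod.total, Category.id_comp]

/-- The exchange property: a local retract of a sum is a retract of one of the summands. -/
lemma retract_or_retract_of_biprod [HasBinaryBiproducts C] {L X Y : C}
    (hL : IsLocalRing (End L)) (h : Retract L (X ⊞ Y)) :
    Nonempty (Retract L X) ∨ Nonempty (Retract L Y) := by
  have : IsIso ((h.i ≫ biprod.fst) ≫ (biprod.inl ≫ h.r) +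
      (h.i ≫ biprod.snd) ≫ (biprod.inr ≫ h.r)) := by
    rw [comp_biprod_comp, h.retract]; infer_instance
  rcases isIso_or_isIso_of_add hL _ _ (h := this) with h1 | h1
  · exact Or.inl ⟨retractOfIsIsoComp (h.i ≫ biprod.fst) (biprod.inl ≫ h.r)⟩
  · exact Or.inr ⟨retractOfIsIsoComp (h.i ≫ biprod.snd) (biprod.inr ≫ h.r)⟩

end LocalObjects

/-! ### Krull-Schmidt categories -/

section KrullSchmidt

variable {C : Type u} [Category.{v} C] [Preadditive C] [HasFiniteBiproducts C]

/-- Splitting off the first summand of a finite biproduct. -/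
noncomputable def biproductSuccIso {n : ℕ} (Y : Fin (n + 1) → C) :
    (⨁ Y) ≅ Y 0 ⊞ ⨁ fun i : Fin n => Y i.succ where
  hom := biprod.lift (biproduct.π Y 0) (biproduct.lift fun i : Fin n => biproduct.π Y i.succ)
  inv := biprod.desc (biproduct.ι Y 0) (biproduct.desc fun i : Fin n => biproduct.ι Y i.succ)
  hom_inv_id := by
    rw [biprod.lift_desc, biproduct.lift_desc, ← Fin.sum_univ_succ
      (fun i => biproduct.π Y i ≫ biproduct.ι Y i), biproduct.total]
  inv_hom_id := by
    apply biprod.hom_ext' <;> apply biprod.hom_ext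
    · simp
    · apply biproduct.hom_ext; intro i
      simp [biproduct.ι_π_ne _ (Fin.succ_ne_zero i).symm]
    · apply biproduct.hom_ext'; intro i
      simp [biproduct.ι_π_ne _ (Fin.succ_ne_zero i)]
    · apply biproduct.hom_ext; intro j
      apply biproduct.hom_ext'; intro i
      by_cases hij : i = j
      · subst hij; simp
      · have : i.succ ≠ j.succ := fun h => hij (Fin.succ_injective _ h)
        simp [biproduct.ι_π_ne _ hij, biproduct.ι_π_ne _ this]

lemma isZero_biproduct_fin_zero (Y : Fin 0 → C) : IsZero (⨁ Y) := by
  rw [IsZero.iff_id_eq_zero]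
  exact biproduct.hom_ext _ _ fun i => i.elim0

/-- Induction on the number of indecomposable summands: a property of objects that is invariant
under isomorphism, holds for zero objects and survives adding an object with local endomorphism
ring holds for all objects. -/
lemma IsKrullSchmidt.induction (hC : IsKrullSchmidt C) {p : C → Prop}
    (iso : ∀ X Y : C, (X ≅ Y) → p X → p Y) (zero : ∀ X : C, IsZero X → p X)
    (add : ∀ L X : C, IsLocalRing (End L) → p X → p (L ⊞ X)) (X : C) : p X := by
  obtain ⟨n, Y, ⟨e⟩, hY⟩ := hC X
  refine iso _ _ e.symm ?_
  clear e X
  induction n with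
  | zero => exact zero _ (isZero_biproduct_fin_zero Y)
  | succ n ih => exact iso _ _ (biproductSuccIso Y).symm (add _ _ (hY 0) (ih _ fun i => hY _))

/-- A local retract of a finite biproduct is a retract of one of the terms. -/
lemma exists_retract_of_biproduct {L : C} (hL : IsLocalRing (End L)) {n : ℕ} (Y : Fin n → C)
    (h : Nonempty (Retract L (⨁ Y))) :
    ∃ i, Nonempty (Retract L (Y i)) := by
  induction n with
  | zero =>
    obtain ⟨h⟩ := h
    refine absurd ?_ (not_isZero_of_isLocalRing hL)
    rw [IsZero.iff_id_eq_zero, ← h.retract, (isZero_biproduct_fin_zero Y).eq_of_tgt h.i 0,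
      zero_comp]
  | succ n ih =>
    obtain ⟨h⟩ := h
    rcases retract_or_retract_of_biprod hL (h.trans (Retract.ofIso (biproductSuccIso Y))) with
      h1 | h1
    · exact ⟨0, h1⟩
    · obtain ⟨i, hi⟩ := ih _ h1
      exact ⟨_, hi⟩

/-- Up to isomorphism, an object of a Krull-Schmidt category has only finitely many local
retracts. -/
lemma IsKrullSchmidt.finite_local_retracts (hC : IsKrullSchmidt C) (M : C) :
    ∃ (n : ℕ) (Y : Fin n → C), ∀ L : C, IsLocalRing (End L) → Nonempty (Retract L M) →
      ∃ i, Nonempty (L ≅ Y i) := by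
  obtain ⟨n, Y, ⟨e⟩, hY⟩ := hC M
  refine ⟨n, Y, fun L hL ⟨h⟩ => ?_⟩
  obtain ⟨i, ⟨r⟩⟩ := exists_retract_of_biproduct hL Y ⟨h.trans (Retract.ofIso e)⟩
  have := r.isIso_of_isLocalRing (not_isZero_of_isLocalRing hL) (hY i)
  exact ⟨i, ⟨asIso r.i⟩⟩

/-- Exchanging the first two summands of a threefold sum. -/
noncomputable def biprodLeftComm (X Y Z : C) : X ⊞ (Y ⊞ Z) ≅ Y ⊞ (X ⊞ Z) where
  hom := biprod.lift (biprod.snd ≫ biprod.fst) (biprod.lift biprod.fst (biprod.snd ≫ biprod.snd))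
  inv := biprod.lift (biprod.snd ≫ biprod.fst) (biprod.lift biprod.fst (biprod.snd ≫ biprod.snd))

/-- A local retract `L` of `M` has a complement, and the complement can be chosen such that the
given inclusion of `L` has an invertible component at `L`. -/
lemma IsKrullSchmidt.exists_complement (hC : IsKrullSchmidt C) {L : C} (hL : IsLocalRing (End L))
    (M : C) : ∀ (c : L ⟶ M) (c' : M ⟶ L), IsIso (c ≫ c') →
      ∃ (Y : C) (e : M ≅ L ⊞ Y), IsIso (c ≫ e.hom ≫ biprod.fst) := by
  refine hC.induction (p := fun M => ∀ (c : L ⟶ M) (c' : M ⟶ L), IsIso (c ≫ c') →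
      ∃ (Y : C) (e : M ≅ L ⊞ Y), IsIso (c ≫ e.hom ≫ biprod.fst)) ?_ ?_ ?_ M
  · intro X X' e hX c c' hc
    obtain ⟨Y, e', h⟩ := hX (c ≫ e.inv) (e.hom ≫ c') (by simpa using hc)
    exact ⟨Y, e.symm ≪≫ e', by simpa using h⟩
  · intro X hX c c' hc
    refine absurd ?_ (not_isZero_of_isLocalRing hL)
    rw [IsZero.iff_id_eq_zero, ← IsIso.hom_inv_id (c ≫ c'), Category.assoc,
      hX.eq_of_src (c' ≫ _) 0, comp_zero]
  · intro L' X hL' ih c c' hc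
    rw [← comp_biprod_comp c c'] at hc
    rcases isIso_or_isIso_of_add hL _ _ (h := hc) with h1 | h1
    · have := isIso_of_isIso_comp_of_isLocalRing hL hL' (c ≫ biprod.fst) (biprod.inl ≫ c')
      refine ⟨X, biprod.mapIso (asIso (c ≫ biprod.fst)).symm (Iso.refl X), ?_⟩
      have : c ≫ (biprod.mapIso (asIso (c ≫ biprod.fst)).symm (Iso.refl X)).hom ≫ biprod.fst =
          𝟙 L := by
        simp only [biprod.mapIso_hom, biprod.map_fst, Iso.symm_hom, asIso_inv]
        rw [← Category.assoc, IsIso.hom_inv_id]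
      rw [this]; infer_instance
    · obtain ⟨Y, e', h⟩ := ih _ _ h1
      refine ⟨L' ⊞ Y, biprod.mapIso (Iso.refl L') e' ≪≫ biprodLeftComm L' L Y, ?_⟩
      simpa [biprodLeftComm] using h

lemma IsKrullSchmidt.exists_iso_biprod_of_retract (hC : IsKrullSchmidt C) {L M : C}
    (hL : IsLocalRing (End L)) (h : Retract L M) : ∃ Y : C, Nonempty (M ≅ L ⊞ Y) := by
  obtain ⟨Y, e, -⟩ := hC.exists_complement hL M h.i h.r (by rw [h.retract]; infer_instance)
  exact ⟨Y, ⟨e⟩⟩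

/-- Objects with local endomorphism rings cancel from direct sums. -/
lemma IsKrullSchmidt.cancel_local (hC : IsKrullSchmidt C) {L X Y : C}
    (hL : IsLocalRing (End L)) (f : L ⊞ X ≅ L ⊞ Y) : Nonempty (X ≅ Y) := by
  have e := comp_biprod_comp (biprod.inl ≫ f.hom) (f.inv ≫ biprod.fst)
  simp only [Category.assoc, Iso.hom_inv_id_assoc, biprod.inl_fst] at e
  have : IsIso ((biprod.inl ≫ f.hom ≫ biprod.fst) ≫ (biprod.inl ≫ f.inv ≫ biprod.fst) +
      (biprod.inl ≫ f.hom ≫ biprod.snd) ≫ (biprod.inr ≫ f.inv ≫ biprod.fst)) := by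
    simp only [Category.assoc]
    rw [e]; infer_instance
  rcases isIso_or_isIso_of_add hL _ _ (h := this) with h1 | h1
  · have := isIso_of_isIso_comp_of_isLocalRing hL hL (biprod.inl ≫ f.hom ≫ biprod.fst)
      (biprod.inl ≫ f.inv ≫ biprod.fst)
    exact ⟨Biprod.isoElim f⟩
  · obtain ⟨Y', e', h⟩ := hC.exists_complement hL Y _ _ h1
    -- `Y` contains a second copy of `L`, hit isomorphically by `f`: eliminate along that copy
    let f' : L ⊞ X ≅ L ⊞ (L ⊞ Y') :=
      f ≪≫ biprod.mapIso (Iso.refl L) e' ≪≫ biprodLeftComm L L Y'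
    have : IsIso (biprod.inl ≫ f'.hom ≫ biprod.fst) := by
      simpa [f', biprodLeftComm] using h
    exact ⟨Biprod.isoElim f' ≪≫ e'.symm⟩

/-- The cancellation property of Krull-Schmidt categories. -/
lemma IsKrullSchmidt.cancel (hC : IsKrullSchmidt C) (Z : C) :
    ∀ X Y : C, (Z ⊞ X ≅ Z ⊞ Y) → Nonempty (X ≅ Y) := by
  refine hC.induction (p := fun Z => ∀ X Y : C, (Z ⊞ X ≅ Z ⊞ Y) → Nonempty (X ≅ Y)) ?_ ?_ ?_ Z
  · intro Z Z' e h X Y f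
    exact h X Y (biprod.mapIso e (Iso.refl X) ≪≫ f ≪≫ biprod.mapIso e.symm (Iso.refl Y))
  · intro Z hZ X Y f
    have : IsIso ((biprod.inl : Z ⟶ Z ⊞ X) ≫ f.hom ≫ biprod.fst) := ⟨0, hZ.eq_of_src _ _,
      hZ.eq_of_src _ _⟩
    exact ⟨Biprod.isoElim f⟩
  · intro L Z hL ih X Y f
    obtain ⟨g⟩ := hC.cancel_local hL ((biprod.associator L Z X).symm ≪≫ f ≪≫
      biprod.associator L Z Y)
    exact ih X Y g

end KrullSchmidt

/-! ### Fitting's lemma for finitely generated subgroups -/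

/-- The kernels of the powers of `f` on a finitely generated subgroup form an ascending chain,
which becomes stationary by noetherianity; from there on `f` is injective on the images. -/
lemma exists_bijOn_iterate {G : Type*} [AddCommGroup G] (f : G →+ G) (X : AddSubgroup G)
    (hX : X.FG) : ∃ k : ℕ, ∀ m : ℕ, k ≤ m →
      Set.BijOn f (f^[m] '' (X : Set G)) (f^[m + 1] '' (X : Set G)) := by
  have hN : IsNoetherian ℤ (AddSubgroup.toIntSubmodule X) := by
    refine isNoetherian_of_fg_of_noetherian _ ((Submodule.fg_iff_addSubgroup_fg _).2 ?_)
    simpa using hX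
  let c : ℕ →o Submodule ℤ (AddSubgroup.toIntSubmodule X) :=
    ⟨fun n => LinearMap.ker ((f.toIntLinearMap ^ n).comp (AddSubgroup.toIntSubmodule X).subtype),
      monotone_nat_of_le_succ fun n x hx => by
        rw [LinearMap.mem_ker, LinearMap.comp_apply] at hx ⊢
        rw [pow_succ', Module.End.mul_apply, hx, map_zero]⟩
  obtain ⟨k, hk⟩ := monotone_stabilizes_iff_noetherian.2 hN c
  have key : ∀ n : ℕ, k ≤ n → ∀ x ∈ X, f^[n] x = 0 → f^[k] x = 0 := by
    intro n hn x hx h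
    have : (⟨x, hx⟩ : AddSubgroup.toIntSubmodule X) ∈ c n := by
      change (f.toIntLinearMap ^ n) x = 0
      rwa [Module.End.pow_apply]
    rw [← hk n hn] at this
    change (f.toIntLinearMap ^ k) x = 0 at this
    rwa [Module.End.pow_apply] at this
  refine ⟨k, fun m hm => ⟨?_, ?_, ?_⟩⟩
  · rintro _ ⟨x, hx, rfl⟩
    exact ⟨x, hx, Function.iterate_succ_apply' f m x⟩
  · rintro _ ⟨x, hx, rfl⟩ _ ⟨y, hy, rfl⟩ h
    rw [← sub_eq_zero, ← iterate_map_sub f m]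
    rw [← Function.iterate_succ_apply' f, ← Function.iterate_succ_apply' f, ← sub_eq_zero,
      ← iterate_map_sub f] at h
    obtain ⟨j, rfl⟩ := Nat.exists_eq_add_of_le' hm
    rw [Function.iterate_add_apply,
      key _ (by omega) _ (X.sub_mem hx hy) h, iterate_map_zero]
  · rintro _ ⟨x, hx, rfl⟩
    exact ⟨_, ⟨x, hx, rfl⟩, (Function.iterate_succ_apply' f m x).symm⟩

/-- An element of a finitely generated subgroup that is killed by some power of `f` is already
killed by the power given by the Fitting index. -/
lemma iterate_fittingIndex_eq_zero {G : Type*} [AddCommGroup G] (f : G →+ G) {X : AddSubgroup G}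
    (hX : X.FG) {x : G} (hx : x ∈ X) {n : ℕ} (h : f^[n] x = 0) :
    f^[ExactStructure.fittingIndex f X] x = 0 := by
  have hmem := Nat.sInf_mem (exists_bijOn_iterate f X hX)
  change ∀ m : ℕ, ExactStructure.fittingIndex f X ≤ m → _ at hmem
  generalize ExactStructure.fittingIndex f X = k at hmem ⊢
  induction n with
  | zero =>
    rw [Function.iterate_zero_apply] at h
    rw [h, iterate_map_zero]
  | succ n ih =>
    rcases le_or_gt k n with hkn | hkn
    · refine ih ((hmem n hkn).injOn ⟨x, hx, rfl⟩ ⟨0, X.zero_mem, iterate_map_zero f n⟩ ?_)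
      rw [← Function.iterate_succ_apply' f, h, map_zero]
    · obtain ⟨j, rfl⟩ := Nat.exists_eq_add_of_le' hkn
      rw [Function.iterate_add_apply, h, iterate_map_zero]

namespace ExactStructure

/-! ### Equality in the group of stable isomorphism classes -/

section StableClass

variable {C : Type u} [Category.{v} C] [Preadditive C] [HasFiniteBiproducts C]

/-- Exchanging the two middle summands of a fourfold sum. -/
noncomputable def biprodInterchange (X Y Z W : C) : (X ⊞ Y) ⊞ (Z ⊞ W) ≅ (X ⊞ Z) ⊞ (Y ⊞ W) where
  hom := biprod.lift (biprod.map biprod.fst biprod.fst) (biprod.map biprod.snd biprod.snd)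
  inv := biprod.lift (biprod.map biprod.fst biprod.fst) (biprod.map biprod.snd biprod.snd)

variable (E : ExactStructure C)

/-- Two objects are stably isomorphic when they become isomorphic after adding suitable
`E`-projective summands. -/
def StablyIso (X Y : C) : Prop :=
  ∃ P Q : C, E.IsProjective P ∧ E.IsProjective Q ∧ Nonempty (X ⊞ P ≅ Y ⊞ Q)

/-- Stable isomorphism as an equivalence relation on objects. -/
def stablyIsoSetoid : Setoid C where
  r := E.StablyIso
  iseqv :=
    { refl := fun X => by
        obtain ⟨P, hP⟩ := E.exists_isProjective
        exact ⟨P, P, hP, hP, ⟨Iso.refl _⟩⟩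
      symm := fun ⟨P, Q, hP, hQ, ⟨e⟩⟩ => ⟨Q, P, hQ, hP, ⟨e.symm⟩⟩
      trans := fun {X Y Z} ⟨P, Q, hP, hQ, ⟨e⟩⟩ ⟨P', Q', hP', hQ', ⟨e'⟩⟩ =>
        ⟨P ⊞ P', Q' ⊞ Q, hP.biprod hP', hQ'.biprod hQ,
          ⟨(biprod.associator X P P').symm ≪≫ biprod.mapIso e (Iso.refl P') ≪≫
            biprod.associator Y Q P' ≪≫ biprod.mapIso (Iso.refl Y) (biprod.braiding Q P') ≪≫
            (biprod.associator Y P' Q).symm ≪≫ biprod.mapIso e' (Iso.refl Q) ≪≫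
            biprod.associator Z Q' Q⟩⟩ }

variable {E}

lemma StablyIso.of_iso {X Y : C} (e : X ≅ Y) : E.StablyIso X Y := by
  obtain ⟨P, hP⟩ := E.exists_isProjective
  exact ⟨P, P, hP, hP, ⟨biprod.mapIso e (Iso.refl P)⟩⟩

lemma StablyIso.biprod {X X' Y Y' : C} (h : E.StablyIso X X') (h' : E.StablyIso Y Y') :
    E.StablyIso (X ⊞ Y) (X' ⊞ Y') := by
  obtain ⟨P, Q, hP, hQ, ⟨e⟩⟩ := h
  obtain ⟨P', Q', hP', hQ', ⟨e'⟩⟩ := h'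
  exact ⟨P ⊞ P', Q ⊞ Q', hP.biprod hP', hQ.biprod hQ',
    ⟨biprodInterchange X Y P P' ≪≫ biprod.mapIso e e' ≪≫ biprodInterchange X' Q Y' Q'⟩⟩

lemma StablyIso.projective_biprod {P : C} (hP : E.IsProjective P) (X : C) :
    E.StablyIso (P ⊞ X) X := by
  obtain ⟨Q, hQ⟩ := E.exists_isProjective
  exact ⟨Q, P ⊞ Q, hQ, hP.biprod hQ,
    ⟨biprod.associator P X Q ≪≫ biprodLeftComm P X Q⟩⟩

/-- In a Krull-Schmidt category, stable isomorphism is cancellative. -/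
lemma StablyIso.cancel (hC : IsKrullSchmidt C) {X Y Z : C} (h : E.StablyIso (Z ⊞ X) (Z ⊞ Y)) :
    E.StablyIso X Y := by
  obtain ⟨P, Q, hP, hQ, ⟨e⟩⟩ := h
  obtain ⟨e'⟩ := hC.cancel Z _ _
    ((biprod.associator Z X P).symm ≪≫ e ≪≫ biprod.associator Z Y Q)
  exact ⟨P, Q, hP, hQ, ⟨e'⟩⟩

variable (E)

/-- The type of stable isomorphism classes of objects. -/
def StableClass : Type u := _root_.Quotient E.stablyIsoSetoid

/-- The stable isomorphism class of an object. -/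
def stableClass (X : C) : E.StableClass := _root_.Quotient.mk E.stablyIsoSetoid X

variable {E} in
lemma stableClass_eq_iff {X Y : C} : E.stableClass X = E.stableClass Y ↔ E.StablyIso X Y :=
  _root_.Quotient.eq (r := E.stablyIsoSetoid)

noncomputable instance : Add E.StableClass where
  add := _root_.Quotient.map₂ (fun X Y => X ⊞ Y) fun _ _ h _ _ h' => StablyIso.biprod h h'

noncomputable instance : Zero E.StableClass where
  zero := E.stableClass E.exists_isProjective.choose

/-- Stable isomorphism classes form a commutative monoid under direct sums; the class of any
projective object serves as zero. -/
noncomputable instance : AddCommMonoid E.StableClass where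
  add_assoc := by
    rintro ⟨X⟩ ⟨Y⟩ ⟨Z⟩
    exact stableClass_eq_iff.2 (.of_iso (biprod.associator X Y Z))
  zero_add := by
    rintro ⟨X⟩
    exact stableClass_eq_iff.2 (.projective_biprod E.exists_isProjective.choose_spec X)
  add_zero := by
    rintro ⟨X⟩
    exact (stableClass_eq_iff.2 (.of_iso (biprod.braiding X _))).trans
      (stableClass_eq_iff.2 (.projective_biprod E.exists_isProjective.choose_spec X))
  add_comm := by
    rintro ⟨X⟩ ⟨Y⟩
    exact stableClass_eq_iff.2 (.of_iso (biprod.braiding X Y))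
  nsmul := nsmulRec

variable {E} in
lemma stableClass_of_isProjective {P : C} (hP : E.IsProjective P) : E.stableClass P = 0 := by
  have h := stableClass_eq_iff.2
    (StablyIso.projective_biprod (E := E) E.exists_isProjective.choose_spec P)
  rw [← h]
  exact (stableClass_eq_iff.2 (.of_iso (biprod.braiding _ P))).trans
    (stableClass_eq_iff.2 (.projective_biprod hP _))

lemma isCancelAdd_stableClass (hC : IsKrullSchmidt C) : IsCancelAdd E.StableClass := by
  have : IsLeftCancelAdd E.StableClass := ⟨by
    rintro ⟨Z⟩ ⟨X⟩ ⟨Y⟩ h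
    exact stableClass_eq_iff.2 ((stableClass_eq_iff.1 h).cancel hC)⟩
  exact AddCommMagma.IsLeftCancelAdd.toIsCancelAdd _

/-- The homomorphism from the free abelian group on isomorphism classes to the Grothendieck group
of the monoid of stable isomorphism classes. -/
noncomputable def toGrothendieck : FreeAbelianGroup (_root_.Quotient (isIsomorphicSetoid C)) →+
    Algebra.GrothendieckAddGroup E.StableClass :=
  FreeAbelianGroup.lift (_root_.Quotient.lift
    (fun X : C => Algebra.GrothendieckAddGroup.of (E.stableClass X)) (by
      rintro X Y ⟨e⟩
      rw [stableClass_eq_iff.2 (.of_iso e)]))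

lemma toGrothendieck_isoClass (X : C) : E.toGrothendieck (isoClass X) =
    Algebra.GrothendieckAddGroup.of (E.stableClass X) :=
  FreeAbelianGroup.lift_apply_of _ _

lemma closure_le_ker_toGrothendieck :
    AddSubgroup.closure E.kRelations ≤ E.toGrothendieck.ker := by
  rw [AddSubgroup.closure_le]
  rintro x (⟨N, S, T, ⟨e⟩, rfl⟩ | ⟨P, hP, rfl⟩)
  · have h : E.stableClass N = E.stableClass S + E.stableClass T :=
      stableClass_eq_iff.2 (.of_iso e)
    simp only [SetLike.mem_coe, AddMonoidHom.mem_ker, map_sub, toGrothendieck_isoClass, h, map_add]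
    abel
  · simp only [SetLike.mem_coe, AddMonoidHom.mem_ker, toGrothendieck_isoClass,
      stableClass_of_isProjective hP, map_zero]

variable {E}

/-- Two objects with the same class in `K` are stably isomorphic: the monoid of stable isomorphism
classes is cancellative, hence embeds into its Grothendieck group. -/
lemma stablyIso_of_cls_eq (hC : IsKrullSchmidt C) {X Y : C} (h : E.cls X = E.cls Y) :
    E.StablyIso X Y := by
  have h1 := E.closure_le_ker_toGrothendieck (QuotientAddGroup.eq.1 h)
  rw [AddMonoidHom.mem_ker, map_add, map_neg, toGrothendieck_isoClass, toGrothendieck_isoClass,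
    neg_add_eq_zero] at h1
  have := E.isCancelAdd_stableClass hC
  exact stableClass_eq_iff.1 (Algebra.GrothendieckAddGroup.of_injective h1)

lemma cls_eq_zero_iff (hC : IsKrullSchmidt C) {P : C} : E.cls P = 0 ↔ E.IsProjective P := by
  refine ⟨fun h => ?_, cls_of_isProjective⟩
  obtain ⟨Q, hQ⟩ := E.exists_isProjective
  obtain ⟨Q₁, Q₂, h₁, h₂, ⟨e⟩⟩ :=
    stablyIso_of_cls_eq (E := E) hC (h.trans (cls_of_isProjective hQ).symm)
  exact (hQ.biprod h₂).of_retract (biprod.inl ≫ e.hom) (e.inv ≫ biprod.fst) (by simp)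

end StableClass

/-! ### Generators of the subgroups `⟨M⟩` -/

section SummandSubgroup

variable {C : Type u} [Category.{v} C] [Preadditive C] [HasFiniteBiproducts C]
  {E : ExactStructure C}

lemma isZero_toStable_iff {X : C} : IsZero (E.toStable.obj X) ↔ E.IsProjective X := by
  rw [IsZero.iff_id_eq_zero]
  constructor
  · intro h
    have h' : E.toStable.map (𝟙 X) = E.toStable.map 0 := by simpa using h
    obtain ⟨P, a, b, hP, e⟩ := (CategoryTheory.Quotient.functor_map_eq_iff E.stableRel _ _).1 h'
    exact hP.of_retract a b (by rw [← e, sub_zero])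
  · intro hX
    have h' : E.toStable.map (𝟙 X) = E.toStable.map 0 :=
      (CategoryTheory.Quotient.functor_map_eq_iff E.stableRel _ _).2
        ⟨X, 𝟙 X, 𝟙 X, hX, by simp⟩
    simpa using h'

lemma toStable_map_eq_zero {X Q Y : C} (hQ : E.IsProjective Q) (a : X ⟶ Q) (b : Q ⟶ Y) :
    E.toStable.map (a ≫ b) = 0 := by
  have : E.toStable.map (a ≫ b) = E.toStable.map 0 :=
    (CategoryTheory.Quotient.functor_map_eq_iff E.stableRel _ _).2 ⟨Q, a, b, hQ, by simp⟩
  simpa using this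

/-- The isomorphism in the stable category expressing that the canonical functor is additive. -/
noncomputable def toStableBiprod (X Y : C) :
    E.toStable.obj (X ⊞ Y) ≅ E.toStable.obj X ⊞ E.toStable.obj Y :=
  have := preservesBinaryBiproducts_of_preservesBiproducts E.toStable
  E.toStable.mapBiprod X Y

/-- A stable retract of `M` that is local and not projective is a retract of `M`: in the local ring
of its endomorphisms, those factoring through projective objects are not invertible. -/
lemma nonempty_retract_of_stable {L M : C} (hL : IsLocalRing (End L)) (hP : ¬E.IsProjective L)
    (h : Retract (E.toStable.obj L) (E.toStable.obj M)) : Nonempty (Retract L M) := by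
  obtain ⟨s, hs⟩ := E.toStable.map_surjective h.i
  obtain ⟨r, hr⟩ := E.toStable.map_surjective h.r
  have h' : E.toStable.map (𝟙 L) = E.toStable.map (s ≫ r) := by
    rw [E.toStable.map_comp, hs, hr, h.retract, E.toStable.map_id]
  obtain ⟨P, a, b, hP', e⟩ := (CategoryTheory.Quotient.functor_map_eq_iff E.stableRel _ _).1 h'
  have : IsIso (s ≫ r + a ≫ b) := by
    rw [← e, add_sub_cancel]; infer_instance
  rcases isIso_or_isIso_of_add hL _ _ (h := this) with h1 | h1
  · exact ⟨retractOfIsIsoComp s r⟩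
  · exact absurd (hP'.of_retract (retractOfIsIsoComp a b).i _ (retractOfIsIsoComp a b).retract) hP

/-- In the stable category, an object with local endomorphism ring is zero or indecomposable. -/
lemma indecomposable_toStable {L : C} (hL : IsLocalRing (End L)) (hP : ¬E.IsProjective L) :
    Indecomposable (E.toStable.obj L) := by
  refine ⟨fun h => hP (isZero_toStable_iff.1 h), ?_⟩
  rintro ⟨Y⟩ ⟨Z⟩ e
  -- the two idempotents of the decomposition, one of which lifts to an automorphism of `L`
  let e₁ : E.toStable.obj L ⟶ E.toStable.obj L := e.hom ≫ biprod.fst ≫ biprod.inl ≫ e.inv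
  let e₂ : E.toStable.obj L ⟶ E.toStable.obj L := e.hom ≫ biprod.snd ≫ biprod.inr ≫ e.inv
  have h12 : e₁ ≫ e₂ = 0 := by simp [e₁, e₂]
  have h21 : e₂ ≫ e₁ = 0 := by simp [e₁, e₂]
  have hsum : e₁ + e₂ = 𝟙 _ := by
    have := comp_biprod_comp e.hom e.inv
    simpa [e₁, e₂] using this
  obtain ⟨a, ha⟩ := E.toStable.map_surjective e₁
  have hb : E.toStable.map (𝟙 L - a) = e₂ := by
    rw [Functor.map_sub, ha, CategoryTheory.Functor.map_id, ← hsum, add_sub_cancel_left]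
  have : IsIso (a + (𝟙 L - a)) := by
    rw [add_sub_cancel]; infer_instance
  rcases isIso_or_isIso_of_add hL _ _ (h := this) with h1 | h1
  · right
    have : IsIso e₁ := by rw [← ha]; infer_instance
    have h0 : e₂ = 0 := by rw [← cancel_epi e₁, h12, comp_zero]
    rw [IsZero.iff_id_eq_zero]
    calc _ = biprod.inr ≫ e.inv ≫ e₂ ≫ e.hom ≫ biprod.snd := by simp [e₂]
      _ = 0 := by simp [h0]
  · left
    have : IsIso e₂ := by rw [← hb]; infer_instance
    have h0 : e₁ = 0 := by rw [← cancel_epi e₂, h21, comp_zero]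
    rw [IsZero.iff_id_eq_zero]
    calc _ = biprod.inl ≫ e.inv ≫ e₁ ≫ e.hom ≫ biprod.fst := by simp [e₁]
      _ = 0 := by simp [h0]

/-- A stably indecomposable object is, up to projective summands, a local object. -/
lemma exists_local_of_indecomposable (hC : IsKrullSchmidt C) (N : C) :
    Indecomposable (E.toStable.obj N) → ∃ L : C, IsLocalRing (End L) ∧ ¬E.IsProjective L ∧
      Nonempty (Retract L N) ∧ E.cls N = E.cls L := by
  refine hC.induction (p := fun N => Indecomposable (E.toStable.obj N) →
    ∃ L : C, IsLocalRing (End L) ∧ ¬E.IsProjective L ∧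
      Nonempty (Retract L N) ∧ E.cls N = E.cls L) ?_ ?_ ?_ N
  · rintro X Y e hX hY
    obtain ⟨L, hL, hP, ⟨h⟩, hcls⟩ := hX ⟨fun h => hY.1 (h.of_iso (E.toStable.mapIso e.symm)),
      fun S T f => hY.2 S T (E.toStable.mapIso e.symm ≪≫ f)⟩
    exact ⟨L, hL, hP, ⟨h.trans (Retract.ofIso e)⟩, (cls_eq_of_iso e.symm).trans hcls⟩
  · exact fun X hX h => absurd (E.toStable.map_isZero hX) h.1
  · intro L X hL ih h
    by_cases hP : E.IsProjective L
    · have eX : E.toStable.obj (L ⊞ X) ≅ E.toStable.obj X :=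
        toStableBiprod L X ≪≫ (isoZeroBiprod (isZero_toStable_iff.2 hP)).symm
      obtain ⟨L', hL', hP', ⟨h'⟩, hcls⟩ := ih ⟨fun h0 => h.1 (h0.of_iso eX),
        fun S T f => h.2 S T (eX ≪≫ f)⟩
      refine ⟨L', hL', hP', ⟨h'.trans ⟨biprod.inr, biprod.snd, biprod.inr_snd⟩⟩, ?_⟩
      rw [cls_biprod, cls_of_isProjective hP, zero_add, hcls]
    · refine ⟨L, hL, hP, ⟨⟨biprod.inl, biprod.fst, biprod.inl_fst⟩⟩, ?_⟩
      rcases h.2 _ _ (toStableBiprod L X) with h0 | h0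
      · exact absurd (isZero_toStable_iff.1 h0) hP
      · rw [cls_biprod, cls_of_isProjective (isZero_toStable_iff.1 h0), add_zero]

/-- The subgroup `⟨M⟩` is generated by the classes of the finitely many local retracts of `M`. -/
lemma fg_summandSubgroup (hC : IsKrullSchmidt C) (M : C) : (E.summandSubgroup M).FG := by
  obtain ⟨n, Y, hY⟩ := hC.finite_local_retracts M
  rw [AddSubgroup.fg_iff]
  refine ⟨_, rfl, (Set.finite_range fun i => E.cls (Y i)).subset ?_⟩
  rintro _ ⟨N, hN, ⟨Z, ⟨e⟩⟩, rfl⟩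
  obtain ⟨L, hL, hP, ⟨h⟩, hcls⟩ := exists_local_of_indecomposable hC N hN
  have hM : Retract (E.toStable.obj N) (E.toStable.obj M) :=
    ⟨biprod.inl ≫ e.inv, e.hom ≫ biprod.fst, by simp⟩
  obtain ⟨i, ⟨f⟩⟩ := hY L hL (nonempty_retract_of_stable hL hP ((h.map E.toStable).trans hM))
  exact ⟨i, ((hcls.trans (cls_eq_of_iso f))).symm⟩

/-- The subgroup `⟨M⟩` contains the classes of all retracts of `M`. -/
lemma cls_mem_summandSubgroup (hC : IsKrullSchmidt C) {M : C} (N : C) :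
    Nonempty (Retract N M) → E.cls N ∈ E.summandSubgroup M := by
  refine hC.induction (p := fun N => Nonempty (Retract N M) →
    E.cls N ∈ E.summandSubgroup M) ?_ ?_ ?_ N
  · rintro X Y e hX ⟨h⟩
    rw [← cls_eq_of_iso e]
    exact hX ⟨(Retract.ofIso e).trans h⟩
  · intro X hX _
    rw [cls_of_isProjective (isZero_toStable_iff.1 (E.toStable.map_isZero hX))]
    exact zero_mem _
  · rintro L X hL ih ⟨h⟩
    have hLM : Retract L M := .trans ⟨biprod.inl, biprod.fst, biprod.inl_fst⟩ h
    rw [cls_biprod]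
    refine add_mem ?_ (ih ⟨.trans ⟨biprod.inr, biprod.snd, biprod.inr_snd⟩ h⟩)
    by_cases hP : E.IsProjective L
    · rw [cls_of_isProjective hP]
      exact zero_mem _
    · obtain ⟨Y, ⟨e⟩⟩ := hC.exists_iso_biprod_of_retract hL hLM
      exact AddSubgroup.subset_closure ⟨L, indecomposable_toStable hL hP,
        ⟨E.toStable.obj Y, ⟨E.toStable.mapIso e ≪≫ toStableBiprod L Y⟩⟩, rfl⟩

end SummandSubgroup

/-! ### Projective dimension in terms of syzygies -/

section ProjectiveDimension

variable {C : Type u} [Category.{v} C] [Preadditive C] {E : ExactStructure C}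

lemma epi_of_exact {K B D : C} {i : K ⟶ B} {p : B ⟶ D} {w : i ≫ p = 0}
    (h : E.exact (ShortComplex.mk i p w)) {X : C} (f g : D ⟶ X) (hfg : p ≫ f = p ≫ g) :
    f = g := by
  obtain ⟨l⟩ := E.isCokernel _ h
  exact Cofork.IsColimit.hom_ext l hfg

lemma exists_desc_of_exact {K B D : C} {i : K ⟶ B} {p : B ⟶ D} {w : i ≫ p = 0}
    (h : E.exact (ShortComplex.mk i p w)) {X : C} (f : B ⟶ X) (hf : i ≫ f = 0) :
    ∃ g : D ⟶ X, p ≫ g = f := by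
  obtain ⟨l⟩ := E.isCokernel _ h
  exact ⟨l.desc (CokernelCofork.ofπ f hf), l.fac _ WalkingParallelPair.one⟩

/-- A short exact sequence whose first arrow has a retraction splits. -/
lemma exists_section_of_exact {K B D : C} {i : K ⟶ B} {p : B ⟶ D} {w : i ≫ p = 0}
    (h : E.exact (ShortComplex.mk i p w)) (r : B ⟶ K) (hr : i ≫ r = 𝟙 K) :
    ∃ s : D ⟶ B, s ≫ p = 𝟙 D := by
  obtain ⟨s, hs⟩ := exists_desc_of_exact h (𝟙 B - r ≫ i) (by simp [reassoc_of% hr])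
  exact ⟨s, epi_of_exact h _ _ (by rw [reassoc_of% hs]; simp [w])⟩

/-- A short exact sequence with projective quotient splits. -/
lemma exists_retraction_of_exact {K B D : C} {i : K ⟶ B} {p : B ⟶ D} {w : i ≫ p = 0}
    (h : E.exact (ShortComplex.mk i p w)) (hD : E.IsProjective D) :
    ∃ r : B ⟶ K, i ≫ r = 𝟙 K := by
  obtain ⟨s, hs⟩ := hD.lift h (𝟙 D)
  obtain ⟨r, hr⟩ := exists_lift_of_exact h (𝟙 B - p ≫ s) (by simp [hs])
  exact ⟨r, mono_of_exact h _ _ (by simp [hr, reassoc_of% w])⟩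

namespace ProjectiveResolution

variable {M : C} (R : ProjectiveResolution E M)

lemma subsingleton_cohomology_iff (B : C) (n : ℕ) :
    Subsingleton (R.cohomology B n) ↔ R.cocycles B n ≤ R.coboundaries B n := by
  rw [QuotientAddGroup.subsingleton_iff, AddSubgroup.addSubgroupOf_eq_top]

lemma mem_cocycles_iff {B : C} {n : ℕ} (f : R.P n ⟶ B) : f ∈ R.cocycles B n ↔ R.ι n ≫ f = 0 := by
  change (R.π (n + 1) ≫ R.ι n) ≫ f = 0 ↔ _
  rw [Category.assoc]
  exact ⟨fun h => epi_of_exact (R.exact _) _ _ (by rw [h, comp_zero]), fun h => by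
    rw [h, comp_zero]⟩

lemma mem_coboundaries_succ_iff {B : C} {n : ℕ} (f : R.P (n + 1) ⟶ B) :
    f ∈ R.coboundaries B (n + 1) ↔ ∃ g : R.P n ⟶ B, R.π (n + 1) ≫ R.ι n ≫ g = f := by
  change (∃ g : R.P n ⟶ B, (R.π (n + 1) ≫ R.ι n) ≫ g = f) ↔ _
  simp only [Category.assoc]

/-- If the cohomology in degree `n + 1` with coefficients in the cycle object `Z (n + 1)` vanishes,
then the inclusion `Z (n + 1) ⟶ P n` splits, whence `Z n` is projective. -/
lemma isProjective_of_subsingleton (n : ℕ)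
    (h : Subsingleton (R.cohomology (R.Z (n + 1)) (n + 1))) : E.IsProjective (R.Z n) := by
  have h1 : R.π (n + 1) ∈ R.coboundaries (R.Z (n + 1)) (n + 1) :=
    (R.subsingleton_cohomology_iff _ _).1 h ((R.mem_cocycles_iff _).2 (R.w _))
  obtain ⟨g, hg⟩ := (R.mem_coboundaries_succ_iff _).1 h1
  have hg' : R.ι n ≫ g = 𝟙 _ := epi_of_exact (R.exact (n + 1)) _ _ (by rw [hg, Category.comp_id])
  obtain ⟨s, hs⟩ := exists_section_of_exact (R.exact n) g hg'
  exact (R.projective n).of_retract s _ hs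

lemma isProjective_Z_of_le {m n : ℕ} (hmn : m ≤ n) (h : E.IsProjective (R.Z m)) :
    E.IsProjective (R.Z n) := by
  induction hmn with
  | refl => exact h
  | step _ ih => exact IsSyzygy.isProjective ⟨_, _, _, _, R.exact _, R.projective _⟩ ih

lemma subsingleton_of_isProjective (n : ℕ) (h : E.IsProjective (R.Z n)) (B : C) :
    Subsingleton (R.cohomology B (n + 1)) := by
  rw [subsingleton_cohomology_iff]
  intro f hf
  obtain ⟨g, hg⟩ := exists_desc_of_exact (R.exact (n + 1)) f ((R.mem_cocycles_iff f).1 hf)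
  obtain ⟨r, hr⟩ := exists_retraction_of_exact (R.exact n) h
  exact (R.mem_coboundaries_succ_iff f).2 ⟨r ≫ g, by rw [reassoc_of% hr, hg]⟩

end ProjectiveResolution

variable [E.EnoughProjectives]

lemma pd_le_iff_isProjective (M : C) (n : ℕ) :
    E.pd M ≤ n ↔ E.IsProjective (E.iteratedSyzygy M n) := by
  constructor
  · intro h
    have h' : E.pd M < (n + 1 : ℕ) := h.trans_lt (by exact_mod_cast Nat.lt_succ_self n)
    simp only [pd, iInf_lt_iff] at h'
    obtain ⟨k, hk, hkn⟩ := h'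
    have hkn' : k < n + 1 := by exact_mod_cast hkn
    exact (E.projectiveResolution M).isProjective_of_subsingleton n (hk _ hkn' _)
  · intro h
    refine iInf₂_le n fun j hj B => ?_
    obtain ⟨j, rfl⟩ : ∃ l, j = l + 1 := ⟨j - 1, by omega⟩
    exact (E.projectiveResolution M).subsingleton_of_isProjective j
      ((E.projectiveResolution M).isProjective_Z_of_le (by omega) h) B

lemma pd_le_zero_iff (M : C) : E.pd M ≤ (0 : ℕ) ↔ E.IsProjective M :=
  pd_le_iff_isProjective M 0

lemma pd_lt_top_iff (M : C) : E.pd M < ⊤ ↔ ∃ n : ℕ, E.pd M ≤ n := by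
  rw [lt_top_iff_ne_top, ENat.ne_top_iff_exists]
  constructor
  · rintro ⟨n, hn⟩
    exact ⟨n, hn.ge⟩
  · rintro ⟨n, hn⟩
    exact ENat.ne_top_iff_exists.1 (ne_top_of_le_ne_top (ENat.natCast_ne_top n) hn)

variable [HasFiniteBiproducts C]

lemma cls_iteratedSyzygy (M : C) (n : ℕ) :
    E.cls (E.iteratedSyzygy M n) = E.omega^[n] (E.cls M) := by
  induction n with
  | zero => rfl
  | succ n ih => rw [Function.iterate_succ_apply', ← ih, omega_cls]; rfl

lemma IsSyzygy.cls_eq_omega {K M : C} (h : E.IsSyzygy K M) : E.cls K = E.omega (E.cls M) := by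
  rw [omega_cls]
  exact h.cls_eq (E.isSyzygy_syzygy M)

/-- The projective dimension of an object can be read off from its class in `K`. -/
lemma pd_le_iff (hC : IsKrullSchmidt C) (M : C) (n : ℕ) :
    E.pd M ≤ n ↔ E.omega^[n] (E.cls M) = 0 := by
  rw [pd_le_iff_isProjective, ← cls_eq_zero_iff hC, cls_iteratedSyzygy]

lemma pd_le_biprod_iff (hC : IsKrullSchmidt C) (X Y : C) (n : ℕ) :
    E.pd (X ⊞ Y) ≤ n ↔ E.pd X ≤ n ∧ E.pd Y ≤ n := by
  constructor
  · intro h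
    rw [pd_le_iff hC, cls_biprod, iterate_map_add, ← cls_iteratedSyzygy, ← cls_iteratedSyzygy,
      ← cls_biprod, cls_eq_zero_iff hC] at h
    rw [pd_le_iff_isProjective, pd_le_iff_isProjective]
    exact ⟨h.of_retract biprod.inl biprod.fst biprod.inl_fst,
      h.of_retract biprod.inr biprod.snd biprod.inr_snd⟩
  · rintro ⟨hX, hY⟩
    rw [pd_le_iff hC] at hX hY ⊢
    rw [cls_biprod, iterate_map_add, hX, hY, add_zero]

lemma pd_lt_top_of_biprod (hC : IsKrullSchmidt C) {X Y : C} (h : E.pd (X ⊞ Y) < ⊤) :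
    E.pd X < ⊤ ∧ E.pd Y < ⊤ := by
  obtain ⟨n, hn⟩ := (pd_lt_top_iff _).1 h
  obtain ⟨hX, hY⟩ := (pd_le_biprod_iff hC X Y n).1 hn
  exact ⟨(pd_lt_top_iff _).2 ⟨n, hX⟩, (pd_lt_top_iff _).2 ⟨n, hY⟩⟩

end ProjectiveDimension

/-! ### Additive closures -/

section AddClosure

variable {C : Type u} [Category.{v} C] [Preadditive C] [HasFiniteBiproducts C]

lemma mem_addClosure_of_isZero {W X : C} (hX : IsZero X) : X ∈ addClosure W :=
  ⟨0, X, ⟨(isoZeroBiprod hX).symm ≪≫ hX.iso (isZero_biproduct_fin_zero _)⟩⟩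

lemma biprod_mem_addClosure {W L Y X : C} (e : W ≅ L ⊞ Y) (h : X ∈ addClosure W) :
    (L ⊞ X) ∈ addClosure W := by
  obtain ⟨k, Z, ⟨f⟩⟩ := h
  exact ⟨k + 1, Y ⊞ Z, ⟨biprodInterchange L X Y Z ≪≫ biprod.mapIso e.symm f ≪≫
    (biproductSuccIso (fun _ : Fin (k + 1) => W)).symm⟩⟩

/-- A retract of `W ⊞ P` with `P` projective is the sum of an object of `add W` and a projective
object. -/
lemma exists_iso_biprod_of_retract {E : ExactStructure C} (hC : IsKrullSchmidt C) {W P : C}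
    (hP : E.IsProjective P) (Z : C) : Nonempty (Retract Z (W ⊞ P)) →
      ∃ Z₁ Z₂ : C, Z₁ ∈ addClosure W ∧ E.IsProjective Z₂ ∧ Nonempty (Z ≅ Z₁ ⊞ Z₂) := by
  refine hC.induction (p := fun Z => Nonempty (Retract Z (W ⊞ P)) →
      ∃ Z₁ Z₂ : C, Z₁ ∈ addClosure W ∧ E.IsProjective Z₂ ∧ Nonempty (Z ≅ Z₁ ⊞ Z₂)) ?_ ?_ ?_ Z
  · rintro X Y e hX ⟨h⟩
    obtain ⟨Z₁, Z₂, h₁, h₂, ⟨f⟩⟩ := hX ⟨(Retract.ofIso e).trans h⟩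
    exact ⟨Z₁, Z₂, h₁, h₂, ⟨e.symm ≪≫ f⟩⟩
  · intro X hX _
    exact ⟨X, X, mem_addClosure_of_isZero hX, isZero_toStable_iff.1 (E.toStable.map_isZero hX),
      ⟨isoBiprodZero hX⟩⟩
  · rintro L X hL ih ⟨h⟩
    obtain ⟨Z₁, Z₂, h₁, h₂, ⟨f⟩⟩ := ih ⟨.trans ⟨biprod.inr, biprod.snd, biprod.inr_snd⟩ h⟩
    rcases retract_or_retract_of_biprod hL (.trans ⟨biprod.inl, biprod.fst, biprod.inl_fst⟩ h) with
      ⟨⟨hLW⟩⟩ | ⟨⟨hLP⟩⟩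
    · obtain ⟨Y, ⟨e⟩⟩ := hC.exists_iso_biprod_of_retract hL hLW
      exact ⟨L ⊞ Z₁, Z₂, biprod_mem_addClosure e h₁, h₂,
        ⟨biprod.mapIso (Iso.refl L) f ≪≫ (biprod.associator L Z₁ Z₂).symm⟩⟩
    · exact ⟨Z₁, L ⊞ Z₂, h₁, (hP.of_retract _ _ hLP.retract).biprod h₂,
        ⟨biprod.mapIso (Iso.refl L) f ≪≫ biprodLeftComm L Z₁ Z₂⟩⟩

variable (E : ExactStructure C) [E.EnoughProjectives]

/-- The finitistic dimension of `add W` is finite, as `add W` contains only finitely many local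
objects up to isomorphism. -/
lemma fpd_addClosure_lt_top (hC : IsKrullSchmidt C) (W : C) : E.fpd (addClosure W) < ⊤ := by
  obtain ⟨n, Y, hY⟩ := hC.finite_local_retracts W
  let N : ℕ := Finset.univ.sup fun i => (E.pd (Y i)).toNat
  have key : ∀ X : C, (∃ k : ℕ, Nonempty (Retract X (⨁ fun _ : Fin k => W))) → E.pd X < ⊤ →
      E.pd X ≤ N := by
    intro X
    refine hC.induction (p := fun X => (∃ k : ℕ, Nonempty (Retract X (⨁ fun _ : Fin k => W))) →
      E.pd X < ⊤ → E.pd X ≤ N) ?_ ?_ ?_ X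
    · rintro X X' e hX ⟨k, ⟨h⟩⟩ hfin
      have hiff : ∀ m : ℕ, E.pd X ≤ m ↔ E.pd X' ≤ m := fun m => by
        rw [pd_le_iff hC, pd_le_iff hC, cls_eq_of_iso e]
      obtain ⟨m, hm⟩ := (pd_lt_top_iff _).1 hfin
      exact (hiff N).1 (hX ⟨k, ⟨(Retract.ofIso e).trans h⟩⟩
        ((pd_lt_top_iff _).2 ⟨m, (hiff m).2 hm⟩))
    · intro X hX _ _
      have hX' : E.IsProjective X := isZero_toStable_iff.1 (E.toStable.map_isZero hX)
      rw [pd_le_iff hC, cls_of_isProjective hX', iterate_map_zero]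
    · rintro L X hL ih ⟨k, ⟨h⟩⟩ hfin
      obtain ⟨hfinL, hfinX⟩ := pd_lt_top_of_biprod hC hfin
      refine (pd_le_biprod_iff hC _ _ _).2
        ⟨?_, ih ⟨k, ⟨.trans ⟨biprod.inr, biprod.snd, biprod.inr_snd⟩ h⟩⟩ hfinX⟩
      obtain ⟨-, hLW⟩ := exists_retract_of_biproduct hL _
        ⟨.trans ⟨biprod.inl, biprod.fst, biprod.inl_fst⟩ h⟩
      obtain ⟨i, ⟨e⟩⟩ := hY L hL hLW
      have hiff : ∀ m : ℕ, E.pd L ≤ m ↔ E.pd (Y i) ≤ m := fun m => by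
        rw [pd_le_iff hC, pd_le_iff hC, cls_eq_of_iso e]
      obtain ⟨m, hm⟩ := (pd_lt_top_iff _).1 hfinL
      have hY' : E.pd (Y i) ≠ ⊤ := ((pd_lt_top_iff _).2 ⟨m, (hiff m).1 hm⟩).ne
      rw [hiff, ← ENat.natCast_toNat hY', Nat.cast_le]
      exact Finset.le_sup (f := fun i => (E.pd (Y i)).toNat) (Finset.mem_univ i)
  refine lt_of_le_of_lt (iSup₂_le ?_) (ENat.natCast_lt_top N)
  rintro X ⟨⟨k, Z, ⟨e⟩⟩, hfin⟩
  exact key X ⟨k, ⟨biprod.inl ≫ e.hom, e.inv ≫ biprod.fst, by simp⟩⟩ hfin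

end AddClosure

/-! ### Rotating short exact sequences -/

section Rotation

variable {C : Type u} [Category.{v} C] [Preadditive C] {E : ExactStructure C}

lemma exact_of_isos {A B D A' B' D' : C} {f : A ⟶ B} {g : B ⟶ D} {w : f ≫ g = 0}
    (h : E.exact (ShortComplex.mk f g w)) (a : A ≅ A') (b : B ≅ B') (d : D ≅ D') {f' : A' ⟶ B'}
    {g' : B' ⟶ D'} (w' : f' ≫ g' = 0) (hf : a.hom ≫ f' = f ≫ b.hom)
    (hg : b.hom ≫ g' = g ≫ d.hom) : E.exact (ShortComplex.mk f' g' w') :=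
  E.of_iso (ShortComplex.mk f g w) (ShortComplex.mk f' g' w')
    (ShortComplex.isoMk a b d hf hg) h

/-- An admissible epic `P ⟶ B` with kernel `K` turns a short exact sequence `A ⟶ B ⟶ D` into a
short exact sequence `K ⟶ L ⟶ A`, where `L` is the kernel of `P ⟶ B ⟶ D`: the pull-back of
`P ⟶ B` along `A ⟶ B`. -/
lemma exists_exact_of_comp {A B D K P : C} {i : A ⟶ B} {p : B ⟶ D} {w : i ≫ p = 0}
    (h : E.exact (ShortComplex.mk i p w)) {k : K ⟶ P} {q : P ⟶ B} {w' : k ≫ q = 0}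
    (h' : E.exact (ShortComplex.mk k q w')) :
    ∃ (L : C) (l : L ⟶ P) (wl : l ≫ q ≫ p = 0) (a : L ⟶ A) (b : K ⟶ L) (wb : b ≫ a = 0),
      E.exact (ShortComplex.mk l (q ≫ p) wl) ∧ E.exact (ShortComplex.mk b a wb) ∧
      a ≫ i = l ≫ q ∧ b ≫ l = k := by
  obtain ⟨L, l, wl, hl⟩ := E.comp_epi q p ⟨K, k, w', h'⟩ ⟨A, i, w, h⟩
  obtain ⟨a, ha⟩ := exists_lift_of_exact h (l ≫ q) (by simpa using wl)
  obtain ⟨b, hb⟩ := exists_lift_of_exact hl k (by rw [reassoc_of% w', zero_comp])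
  have wb : b ≫ a = 0 := mono_of_exact h _ _ (by simp [ha, reassoc_of% hb, w'])
  have sq : IsPullback l a q i := by
    refine ⟨⟨ha.symm⟩, ⟨PullbackCone.IsLimit.mk _
      (fun s => (exists_lift_of_exact hl s.fst
        (by rw [reassoc_of% s.condition, w, comp_zero])).choose) ?_ ?_ ?_⟩⟩
    · intro s
      exact (exists_lift_of_exact hl s.fst
        (by rw [reassoc_of% s.condition, w, comp_zero])).choose_spec
    · intro s
      have := (exists_lift_of_exact hl s.fst
        (by rw [reassoc_of% s.condition, w, comp_zero])).choose_spec
      exact mono_of_exact h _ _ (by rw [Category.assoc, ha, reassoc_of% this, s.condition])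
    · intro s m hm _
      exact mono_of_exact hl _ _ (hm.trans (exists_lift_of_exact hl s.fst
        (by rw [reassoc_of% s.condition, w, comp_zero])).choose_spec.symm)
  refine ⟨L, l, wl, a, b, wb, hl, ?_, ha, hb⟩
  refine AdmissibleEpi.exact_of_isKernel (AdmissibleEpi.of_isPullback ⟨K, k, w', h'⟩ sq) wb ?_ ?_
  · intro X f g hfg
    exact mono_of_exact h' _ _ (by rw [← hb, reassoc_of% hfg])
  · intro X f hf
    obtain ⟨u, hu⟩ := exists_lift_of_exact h' (f ≫ l) (by
      rw [Category.assoc, ← ha, reassoc_of% hf, zero_comp])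
    exact ⟨u, mono_of_exact hl _ _ (by rw [Category.assoc, hb, hu])⟩

variable [HasFiniteBiproducts C]

/-- A short exact sequence `X ⟶ Y ⟶ D` and admissible epics from projective objects onto `X` and `Y`
give rise to a short exact sequence of syzygies `K ⟶ K' ⊞ P ⟶ L`, whose first arrow is induced by a
lift of `X ⟶ Y` to the projective objects. -/
lemma exists_exact_syzygies {X Y D K P K' P' : C} {f : X ⟶ Y} {g : Y ⟶ D} {w : f ≫ g = 0}
    (h : E.exact (ShortComplex.mk f g w)) {ι : K ⟶ P} {p : P ⟶ X} {wp : ι ≫ p = 0}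
    (hp : E.exact (ShortComplex.mk ι p wp)) (hP : E.IsProjective P) {ι' : K' ⟶ P'}
    {p' : P' ⟶ Y} {wp' : ι' ≫ p' = 0} (hp' : E.exact (ShortComplex.mk ι' p' wp'))
    (hP' : E.IsProjective P') :
    ∃ (L : C) (F : P ⟶ P') (f' : K ⟶ K') (g' : K' ⊞ P ⟶ L) (w' : biprod.lift f' ι ≫ g' = 0),
      E.IsSyzygy L D ∧ F ≫ p' = p ≫ f ∧ ι ≫ F = f' ≫ ι' ∧
      E.exact (ShortComplex.mk (biprod.lift f' ι) g' w') := by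
  obtain ⟨L, l, wl, a, b, wb, hl, hba, hal, hbl⟩ := exists_exact_of_comp h hp'
  obtain ⟨t, ht⟩ := hP.lift hba p
  obtain ⟨f', hf'⟩ := exists_lift_of_exact hba (ι ≫ t) (by rw [Category.assoc, ht, wp])
  have w' : biprod.lift f' ι ≫ biprod.desc b (-t) = 0 := by simp [hf']
  refine ⟨L, t ≫ l, f', biprod.desc b (-t), w', ⟨P', l, p' ≫ g, wl, hl, hP'⟩, ?_, ?_, ?_⟩
  · rw [Category.assoc, ← hal, reassoc_of% ht]
  · rw [← reassoc_of% hf', hbl]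
  · have hsnd : biprod.desc b (-t) ≫ a = (-biprod.snd) ≫ p := by
      apply biprod.hom_ext' <;> simp [wb, ht]
    have sq : IsPullback (-biprod.snd) (biprod.desc b (-t)) p a := by
      have key : ∀ s : PullbackCone p a, ∃ u : s.pt ⟶ K', u ≫ b = s.snd - s.fst ≫ t := fun s =>
        exists_lift_of_exact hba _ (by
          rw [Preadditive.sub_comp, Category.assoc, ht, s.condition, sub_self])
      refine ⟨⟨hsnd.symm⟩, ⟨PullbackCone.IsLimit.mk _
        (fun s => biprod.lift (key s).choose (-s.fst)) ?_ ?_ ?_⟩⟩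
      · intro s
        simp
      · intro s
        simp [(key s).choose_spec]
      · intro s m hm hm'
        have h2 : m ≫ biprod.snd = -s.fst := by
          rw [← hm]; simp
        apply biprod.hom_ext
        · refine mono_of_exact hba _ _ ?_
          rw [biprod.lift_fst, (key s).choose_spec, ← hm', biprod.desc_eq, Preadditive.comp_add,
            Preadditive.comp_neg, Preadditive.comp_neg, reassoc_of% h2]
          simp
        · simpa using h2
    refine AdmissibleEpi.exact_of_isKernel (AdmissibleEpi.of_isPullback ⟨K, ι, wp, hp⟩ sq) w' ?_ ?_
    · intro T u v huv
      exact mono_of_exact hp _ _ (by simpa using huv =≫ biprod.snd)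
    · intro T u hu
      have h2 : (u ≫ biprod.snd) ≫ p = 0 := by
        have := hu =≫ a
        rw [Category.assoc, hsnd] at this
        simpa using this
      obtain ⟨c, hc⟩ := exists_lift_of_exact hp _ h2
      refine ⟨c, ?_⟩
      apply biprod.hom_ext
      · refine mono_of_exact hba _ _ ?_
        rw [biprod.desc_eq, Preadditive.comp_add, Preadditive.comp_neg, Preadditive.comp_neg,
          ← sub_eq_add_neg, sub_eq_zero] at hu
        rw [Category.assoc, Category.assoc, Category.assoc, biprod.lift_fst_assoc, hf',
          reassoc_of% hc, hu]
      · simpa using hc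

/-- The split sequence of a direct sum is short exact. -/
lemma exact_inl_snd (P Q : C) :
    E.exact (ShortComplex.mk (biprod.inl : P ⟶ P ⊞ Q) biprod.snd biprod.inl_snd) := by
  obtain ⟨Z, p, w, h⟩ := E.id_mono P
  have hp : p = 0 := by simpa using w
  have hZ : IsZero Z := by
    rw [IsZero.iff_id_eq_zero]
    exact epi_of_exact h _ _ (by simp [hp])
  have sq : IsPullback (biprod.fst : P ⊞ Q ⟶ P) biprod.snd p (0 : Q ⟶ Z) := by
    refine ⟨⟨hZ.eq_of_tgt _ _⟩, ⟨PullbackCone.IsLimit.mk _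
      (fun s => biprod.lift s.fst s.snd) (by simp) (by simp) ?_⟩⟩
    intro s m hm hm'
    apply biprod.hom_ext <;> simp [hm, hm']
  refine AdmissibleEpi.exact_of_isKernel (AdmissibleEpi.of_isPullback ⟨P, 𝟙 P, w, h⟩ sq) _ ?_ ?_
  · intro X f g hfg
    simpa using hfg =≫ biprod.fst
  · intro X f hf
    exact ⟨f ≫ biprod.fst, by apply biprod.hom_ext <;> simp [hf]⟩

/-- An admissible epic onto `X` gives one onto `X ⊞ R` with the same kernel. -/
lemma exact_lift_map {K P X : C} {ι : K ⟶ P} {p : P ⟶ X} {w : ι ≫ p = 0}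
    (h : E.exact (ShortComplex.mk ι p w)) (R : C) :
    E.exact (ShortComplex.mk (biprod.lift ι (0 : K ⟶ R)) (biprod.map p (𝟙 R))
      (by apply biprod.hom_ext <;> simp [w])) := by
  obtain ⟨Z, i, wi, hi⟩ := E.id_epi R
  refine AdmissibleEpi.exact_of_isKernel ⟨_, _, _, exact_biprod h hi⟩ _ ?_ ?_
  · intro T f g hfg
    exact mono_of_exact h _ _ (by simpa using hfg =≫ biprod.fst)
  · intro T f hf
    obtain ⟨a, ha⟩ := exists_lift_of_exact h (f ≫ biprod.fst) (by simpa using hf =≫ biprod.fst)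
    have h2 : f ≫ biprod.snd = 0 := by simpa using hf =≫ biprod.snd
    exact ⟨a, by apply biprod.hom_ext <;> simp [ha, h2]⟩

end Rotation

/-! ### Projective dimensions in a short exact sequence -/

section PdExact

variable {C : Type u} [Category.{v} C] [Preadditive C] [HasFiniteBiproducts C]
  {E : ExactStructure C}

/-- Stable nilpotency passes from an endomorphism to the endomorphisms it induces on syzygies. -/
lemma isNilpotent_syzygy {K P X : C} {ι : K ⟶ P} {p : P ⟶ X} {w : ι ≫ p = 0}
    (h : E.exact (ShortComplex.mk ι p w)) (hP : E.IsProjective P) (α : End X) (α' : End K)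
    (F : End P) (h1 : F ≫ p = p ≫ α) (h2 : ι ≫ F = α' ≫ ι)
    (hα : IsNilpotent (E.toStable.mapEnd X α)) : IsNilpotent (E.toStable.mapEnd K α') := by
  obtain ⟨k, hk⟩ := hα
  obtain ⟨Fk, h1k, h2k⟩ : ∃ Fk : P ⟶ P,
      Fk ≫ p = p ≫ (α ^ k : End X) ∧ ι ≫ Fk = (α' ^ k : End K) ≫ ι := by
    clear hk
    induction k with
    | zero => exact ⟨𝟙 P, (Category.id_comp p).trans (Category.comp_id p).symm,
        (Category.comp_id ι).trans (Category.id_comp ι).symm⟩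
    | succ k ih =>
      obtain ⟨Fk, h1k, h2k⟩ := ih
      refine ⟨F ≫ Fk, ?_, ?_⟩
      · rw [pow_succ, End.mul_def, Category.assoc, h1k, reassoc_of% h1]
      · rw [pow_succ, End.mul_def, Category.assoc, ← h2k, reassoc_of% h2]
  rw [← map_pow] at hk
  have hk' : E.toStable.map (α ^ k : End X) = E.toStable.map 0 := by simpa using hk
  obtain ⟨Q, a, b, hQ, e⟩ := (CategoryTheory.Quotient.functor_map_eq_iff E.stableRel _ _).1 hk'
  rw [sub_zero] at e
  -- a lift of `α ^ k` factors through `Q`, up to a map into the kernel `K`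
  obtain ⟨b', hb'⟩ := hQ.lift h b
  obtain ⟨c, hc⟩ := exists_lift_of_exact h (Fk - p ≫ a ≫ b') (by
    rw [Preadditive.sub_comp, h1k, e]; simp [hb'])
  have hc' : (α' ^ k : End K) = ι ≫ c := mono_of_exact h _ _ (by
    rw [← h2k, Category.assoc, hc, Preadditive.comp_sub, reassoc_of% w, zero_comp, sub_zero])
  refine ⟨k, ?_⟩
  rw [← map_pow, hc']
  exact toStable_map_eq_zero hP ι c

variable [E.EnoughProjectives]

lemma IsSyzygy.pd_le_succ_iff (hC : IsKrullSchmidt C) {K M : C} (h : E.IsSyzygy K M) (n : ℕ) :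
    E.pd M ≤ (n + 1 : ℕ) ↔ E.pd K ≤ n := by
  rw [pd_le_iff hC, pd_le_iff hC, Function.iterate_succ_apply, h.cls_eq_omega]

lemma pd_le_succ_of_exact (hC : IsKrullSchmidt C) (n : ℕ) : ∀ {X Y D : C} {f : X ⟶ Y} {g : Y ⟶ D}
    {w : f ≫ g = 0}, E.exact (ShortComplex.mk f g w) → E.pd X ≤ n → E.pd Y ≤ n →
    E.pd D ≤ (n + 1 : ℕ) := by
  induction n with
  | zero =>
    intro X Y D f g w h hX hY
    rw [pd_le_zero_iff] at hY
    exact (IsSyzygy.pd_le_succ_iff hC ⟨Y, f, g, w, h, hY⟩ 0).2 hX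
  | succ n ih =>
    intro X Y D f g w h hX hY
    have hsX := E.isSyzygy_syzygy X
    have hsY := E.isSyzygy_syzygy Y
    have hX' := (hsX.pd_le_succ_iff hC n).1 hX
    have hY' := (hsY.pd_le_succ_iff hC n).1 hY
    obtain ⟨P, ι, p, wp, hp, hP⟩ := hsX
    obtain ⟨P', ι', p', wp', hp', hP'⟩ := hsY
    obtain ⟨L, F, f', g', w', hL, -, -, h'⟩ := exists_exact_syzygies h hp hP hp' hP'
    refine (hL.pd_le_succ_iff hC _).2 (ih h' hX' ((pd_le_biprod_iff hC _ _ _).2 ⟨hY', ?_⟩))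
    rw [pd_le_iff hC, cls_of_isProjective hP, iterate_map_zero]

/-- Suppose that the component at `X` of the first arrow of a short exact sequence
`X ⟶ X ⊞ R ⟶ D`, with `R` projective, is stably nilpotent. Then the projective dimension of `X` is
bounded by that of `D`. -/
lemma pd_le_of_isNilpotent (hC : IsKrullSchmidt C) (n : ℕ) : ∀ {X R D : C} {f : X ⟶ X ⊞ R}
    {g : X ⊞ R ⟶ D} {w : f ≫ g = 0}, E.exact (ShortComplex.mk f g w) → E.IsProjective R →
    IsNilpotent (E.toStable.mapEnd X (f ≫ biprod.fst)) → E.pd D ≤ n → E.pd X ≤ n := by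
  induction n with
  | zero =>
    intro X R D f g w h hR hf hD
    rw [pd_le_zero_iff] at hD ⊢
    obtain ⟨r, hr⟩ := exists_retraction_of_exact h hD
    -- in the stable category, the nilpotent arrow has a one-sided inverse
    have h1 : E.toStable.map (f ≫ biprod.fst) ≫ E.toStable.map (biprod.inl ≫ r) = 𝟙 _ := by
      have e := comp_biprod_comp f r
      have h0 := toStable_map_eq_zero hR (f ≫ biprod.snd) (biprod.inr ≫ r)
      rw [← E.toStable.map_comp, ← E.toStable.map_id, ← hr, ← e, E.toStable.map_add, h0, add_zero]
    obtain ⟨k, hk⟩ := hf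
    have h2 := pow_mul_pow_eq_one (M := End (E.toStable.obj X)) k
      (a := E.toStable.map (biprod.inl ≫ r)) (b := E.toStable.map (f ≫ biprod.fst)) h1
    rw [show HPow.hPow (α := End (E.toStable.obj X)) (E.toStable.map (f ≫ biprod.fst)) k = 0 from hk,
      mul_zero] at h2
    exact isZero_toStable_iff.1 ((IsZero.iff_id_eq_zero _).2 h2.symm)
  | succ n ih =>
    intro X R D f g w h hR hf hD
    have hs := E.isSyzygy_syzygy X
    rw [hs.pd_le_succ_iff hC]
    obtain ⟨P, ι, p, wp, hp, hP⟩ := hs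
    obtain ⟨L, F, f', g', w', hL, hF, hF', h'⟩ :=
      exists_exact_syzygies h hp hP (exact_lift_map hp R) (hP.biprod hR)
    refine ih h' hP ?_ ((hL.pd_le_succ_iff hC n).1 hD)
    rw [biprod.lift_fst]
    refine isNilpotent_syzygy hp hP (f ≫ biprod.fst) f' (F ≫ biprod.fst) ?_ ?_ hf
    · simpa using hF =≫ biprod.fst
    · simpa using hF' =≫ biprod.fst

end PdExact

/-! ### Splitting off an automorphism -/

section FittingReduction

variable {C : Type u} [Category.{v} C] [Preadditive C] {E : ExactStructure C}

/-- Admissible monics are stable under all push-outs. -/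
lemma exists_exact_of_isPushout {A B A' B' D : C} {i : A ⟶ B} {p : B ⟶ D} {w : i ≫ p = 0}
    (h : E.exact (ShortComplex.mk i p w)) {f : A ⟶ A'} {f' : B ⟶ B'} {i' : A' ⟶ B'}
    (sq : IsPushout i f f' i') :
    ∃ (Z : C) (q : B' ⟶ Z) (w' : i' ≫ q = 0), E.exact (ShortComplex.mk i' q w') := by
  obtain ⟨X, g', j, sq', Z, q, w', h'⟩ := E.pushout i f ⟨D, p, w, h⟩
  let e : X ≅ B' := sq'.isoIsPushout _ _ sq
  have he : j ≫ e.hom = i' := IsPushout.inr_isoIsPushout_hom _ _ sq' sq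
  have w'' : i' ≫ e.inv ≫ q = 0 := by simp [← he, w']
  exact ⟨Z, e.inv ≫ q, w'', exact_of_isos h' (Iso.refl _) e (Iso.refl _) w'' (by simp [he])
    (by simp)⟩

/-- An admissible monic together with any of its cokernels is a short exact sequence. -/
lemma exact_of_isCokernel {A B D D' : C} {i : A ⟶ B} {p : B ⟶ D} {w : i ≫ p = 0}
    (h : E.exact (ShortComplex.mk i p w)) {q : B ⟶ D'} (w' : i ≫ q = 0)
    (hq : ∀ {X : C} (f g : D' ⟶ X), q ≫ f = q ≫ g → f = g)
    (hl : ∀ {X : C} (f : B ⟶ X), i ≫ f = 0 → ∃ g : D' ⟶ X, q ≫ g = f) :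
    E.exact (ShortComplex.mk i q w') := by
  obtain ⟨a, ha⟩ := exists_desc_of_exact h q w'
  obtain ⟨b, hb⟩ := hl p w
  have hab : a ≫ b = 𝟙 D := epi_of_exact h _ _ (by simp [reassoc_of% ha, hb])
  have hba : b ≫ a = 𝟙 D' := hq _ _ (by simp [reassoc_of% hb, ha])
  let e : D ≅ D' := ⟨a, b, hab, hba⟩
  exact exact_of_isos h (Iso.refl _) (Iso.refl _) e w' (by simp) (by simp [e, ha])

variable [HasFiniteBiproducts C]

/-- If the restriction of an admissible monic `f : Y ⊞ Z ⟶ B` to `Y` is a split monic with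
retraction `ρ` and complement `j : W ⟶ B`, then `Y` can be removed from the short exact
sequence. -/
lemma exact_of_split_summand {Y Z B W D : C} {f : Y ⊞ Z ⟶ B} {g : B ⟶ D} {w : f ≫ g = 0}
    (h : E.exact (ShortComplex.mk f g w)) (j : W ⟶ B) (q : B ⟶ W) (ρ : B ⟶ Y) (f₂ : Z ⟶ W)
    (hjq : j ≫ q = 𝟙 W) (hqj : q ≫ j + ρ ≫ biprod.inl ≫ f = 𝟙 B)
    (hf : biprod.inl ≫ f ≫ q = 0) (hf₂ : biprod.inr ≫ f = f₂ ≫ j) :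
    ∃ w' : f₂ ≫ j ≫ g = 0, E.exact (ShortComplex.mk f₂ (j ≫ g) w') := by
  have hsnd : f ≫ q = biprod.snd ≫ f₂ := by
    apply biprod.hom_ext'
    · simp [hf]
    · simp [reassoc_of% hf₂, hjq]
  have hg : q ≫ j ≫ g = g := by
    have := hqj =≫ g
    simpa [w] using this
  have sq : IsPushout f biprod.snd q f₂ := by
    refine ⟨⟨hsnd⟩, ⟨PushoutCocone.IsColimit.mk _ (fun s => j ≫ s.inl) ?_ ?_ ?_⟩⟩
    · intro s
      have h0 : biprod.inl ≫ f ≫ s.inl = 0 := by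
        rw [s.condition, biprod.inl_snd_assoc, zero_comp]
      have := hqj =≫ s.inl
      simpa [h0] using this
    · intro s
      rw [← reassoc_of% hf₂, s.condition, biprod.inr_snd_assoc]
    · intro s m hm _
      rw [← hm, reassoc_of% hjq]
  obtain ⟨_, _, _, h'⟩ := exists_exact_of_isPushout h sq
  have w' : f₂ ≫ j ≫ g = 0 := by rw [← reassoc_of% hf₂, w, comp_zero]
  refine ⟨w', exact_of_isCokernel h' w' ?_ ?_⟩
  · intro X s t hst
    refine epi_of_exact h _ _ ?_
    rw [← hg, Category.assoc, Category.assoc, Category.assoc, Category.assoc]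
    simp only [Category.assoc] at hst
    rw [hst]
  · intro X s hs
    obtain ⟨t, ht⟩ := exists_desc_of_exact h (q ≫ s) (by rw [reassoc_of% hsnd, hs, comp_zero])
    exact ⟨t, by rw [Category.assoc, ht, reassoc_of% hjq]⟩

/-- By Fitting's property, the component at `X` of the first arrow of a short exact sequence
`X ⟶ X ⊞ R ⟶ D` may be assumed to be nilpotent, after replacing `X` by a direct summand. -/
lemma exists_exact_isNilpotent (hF : HasFittingProperty C) {X R D : C} {f : X ⟶ X ⊞ R}
    {g : X ⊞ R ⟶ D} {w : f ≫ g = 0} (h : E.exact (ShortComplex.mk f g w)) :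
    ∃ (Z : C) (f₂ : Z ⟶ Z ⊞ R) (g₂ : Z ⊞ R ⟶ D) (w₂ : f₂ ≫ g₂ = 0), Nonempty (Retract Z X) ∧
      IsNilpotent (show End Z from f₂ ≫ biprod.fst) ∧ E.exact (ShortComplex.mk f₂ g₂ w₂) := by
  obtain ⟨Y, Z, e, φ, α, hα, hf⟩ := hF X (f ≫ biprod.fst)
  -- the given sequence, transported along `X ≅ Y ⊞ Z`
  let f₁ : Y ⊞ Z ⟶ (Y ⊞ Z) ⊞ R := e.inv ≫ f ≫ biprod.map e.hom (𝟙 R)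
  let g₁ : (Y ⊞ Z) ⊞ R ⟶ D := biprod.map e.inv (𝟙 R) ≫ g
  have hmap : biprod.map e.hom (𝟙 R) ≫ biprod.map e.inv (𝟙 R) = 𝟙 (X ⊞ R) := by
    apply biprod.hom_ext' <;> simp
  have w₁ : f₁ ≫ g₁ = 0 := by simp [f₁, g₁, reassoc_of% hmap, w]
  have h₁ : E.exact (ShortComplex.mk f₁ g₁ w₁) := 
    exact_of_isos h e (biprod.mapIso e (Iso.refl R)) (Iso.refl D) w₁ (by simp [f₁])
      (by simp [g₁, reassoc_of% hmap])
  have hfst : f₁ ≫ biprod.fst = biprod.map φ.hom α := by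
    simp only [f₁, Category.assoc, biprod.map_fst, reassoc_of% hf]
    simp
  obtain ⟨w₂, h₂⟩ := exact_of_split_summand h₁ (W := Z ⊞ R) (biprod.map biprod.inr (𝟙 R))
    (biprod.lift (biprod.fst ≫ biprod.snd)
      (biprod.snd - biprod.fst ≫ biprod.fst ≫ φ.inv ≫ biprod.inl ≫ f₁ ≫ biprod.snd))
    (biprod.fst ≫ biprod.fst ≫ φ.inv) (biprod.lift α (biprod.inr ≫ f₁ ≫ biprod.snd))
    (by apply biprod.hom_ext' <;> apply biprod.hom_ext <;> simp)
    (by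
      apply biprod.hom_ext
      · apply biprod.hom_ext <;> simp [hfst]
      · simp)
    (by
      apply biprod.hom_ext
      · simp [reassoc_of% hfst]
      · simp [reassoc_of% hfst])
    (by
      apply biprod.hom_ext
      · simp [hfst]
      · simp)
  refine ⟨Z, _, _, w₂, ⟨biprod.inr ≫ e.inv, e.hom ≫ biprod.snd, by simp⟩, ?_, h₂⟩
  rw [biprod.lift_fst]
  exact hα

end FittingReduction

/-! ### The Igusa-Todorov bound -/

section IgusaTodorovBound

variable {C : Type u} [Category.{v} C] [Preadditive C] [HasFiniteBiproducts C]
  {E : ExactStructure C} [E.EnoughProjectives]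

/-- Iterated syzygies of a short exact sequence, up to projective summands in the first two
terms. -/
lemma exists_exact_iterate {A B D : C} {i : A ⟶ B} {p : B ⟶ D}
    {w : i ≫ p = 0} (h : E.exact (ShortComplex.mk i p w)) (n : ℕ) :
    ∃ (X Y Z : C) (f : X ⟶ Y) (g : Y ⟶ Z) (w' : f ≫ g = 0),
      E.exact (ShortComplex.mk f g w') ∧ E.cls X = E.omega^[n] (E.cls A) ∧
      E.cls Y = E.omega^[n] (E.cls B) ∧ E.cls Z = E.omega^[n] (E.cls D) := by
  induction n with
  | zero => exact ⟨A, B, D, i, p, w, h, rfl, rfl, rfl⟩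
  | succ n ih =>
    obtain ⟨X, Y, Z, f, g, w', hfg, hX, hY, hZ⟩ := ih
    have hsX := E.isSyzygy_syzygy X
    have hsY := E.isSyzygy_syzygy Y
    have eX := hsX.cls_eq_omega
    have eY := hsY.cls_eq_omega
    obtain ⟨P, ι, q, wq, hq, hP⟩ := hsX
    obtain ⟨P', ι', q', wq', hq', hP'⟩ := hsY
    obtain ⟨L, F, f', g', w'', hL, -, -, h'⟩ := exists_exact_syzygies hfg hq hP hq' hP'
    refine ⟨_, _, _, _, _, w'', h', ?_, ?_, ?_⟩
    · rw [eX, hX, Function.iterate_succ_apply']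
    · rw [cls_biprod, cls_of_isProjective hP, add_zero, eY, hY, Function.iterate_succ_apply']
    · rw [hL.cls_eq_omega, hZ, Function.iterate_succ_apply']

/-- If the quotient of a short exact sequence has finite projective dimension, then `Ω^φ` no
longer distinguishes the classes of the other two terms `A` and `B`, where `φ = Φ(A ⊞ B)`. -/
lemma omega_iterate_phi_eq (hC : IsKrullSchmidt C) {A B D : C} {i : A ⟶ B} {p : B ⟶ D}
    {w : i ≫ p = 0} (h : E.exact (ShortComplex.mk i p w)) (hD : E.pd D < ⊤) :
    E.omega^[E.Phi (A ⊞ B)] (E.cls A) = E.omega^[E.Phi (A ⊞ B)] (E.cls B) := by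
  obtain ⟨n, hn⟩ := (pd_lt_top_iff _).1 hD
  rw [pd_le_iff hC] at hn
  obtain ⟨X, Y, Z, f, g, w', hfg, hX, hY, hZ⟩ := exists_exact_iterate h n
  rw [hn, cls_eq_zero_iff hC] at hZ
  obtain ⟨s, hs⟩ := hZ.lift hfg (𝟙 Z)
  obtain ⟨r, hr⟩ := exists_lift_of_exact hfg (𝟙 Y - g ≫ s) (by simp [hs])
  have hfr : f ≫ r = 𝟙 X := mono_of_exact hfg _ _ (by simp [hr, reassoc_of% w'])
  have hsr : s ≫ r = 0 := mono_of_exact hfg _ _ (by simp [hr, reassoc_of% hs])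
  have e : Y ≅ X ⊞ Z :=
    { hom := biprod.lift r g
      inv := biprod.desc f s
      hom_inv_id := by simp [hr]
      inv_hom_id := by
        apply biprod.hom_ext' <;> apply biprod.hom_ext <;> simp [hfr, hsr, hs, w'] }
  have hXY : E.cls Y = E.cls X := by
    rw [cls_eq_of_iso e, cls_biprod, cls_of_isProjective hZ, add_zero]
  rw [hX, hY, ← sub_eq_zero, ← iterate_map_sub] at hXY
  have hmem : E.cls B - E.cls A ∈ E.summandSubgroup (A ⊞ B) := sub_mem
    (cls_mem_summandSubgroup hC B ⟨biprod.inr, biprod.snd, biprod.inr_snd⟩)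
    (cls_mem_summandSubgroup hC A ⟨biprod.inl, biprod.fst, biprod.inl_fst⟩)
  have := iterate_fittingIndex_eq_zero E.omega (fg_summandSubgroup hC (A ⊞ B)) hmem hXY
  rw [iterate_map_sub, sub_eq_zero] at this
  exact this.symm

/-- If the first two terms of a short exact sequence are stably isomorphic to each other, and the
first one is stably a direct summand of `W`, then the projective dimension of the quotient, if
finite, exceeds the finitistic dimension of `add W` by at most one. -/
lemma pd_le_of_stablyIso (hC : IsKrullSchmidt C) (hF : HasFittingProperty C) {X Y D W V : C}
    {f : X ⟶ Y} {g : Y ⟶ D} {w : f ≫ g = 0} (h : E.exact (ShortComplex.mk f g w))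
    (hXY : E.StablyIso X Y) (hW : E.StablyIso (X ⊞ V) W) (hD : E.pd D < ⊤) :
    E.pd D ≤ ((E.fpd (addClosure W)).toNat + 1 : ℕ) := by
  obtain ⟨P, Q, hP, hQ, ⟨e⟩⟩ := hXY
  -- adding the split sequence `P ⟶ P ⊞ Q ⟶ Q` makes the middle term the sum of the first term
  -- `X ⊞ P` and a projective object
  let m : Y ⊞ (P ⊞ Q) ≅ (X ⊞ P) ⊞ P := biprod.mapIso (Iso.refl Y) (biprod.braiding P Q) ≪≫
    (biprod.associator Y Q P).symm ≪≫ biprod.mapIso e.symm (Iso.refl P)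
  have w₀ : (biprod.map f (biprod.inl : P ⟶ P ⊞ Q) ≫ m.hom) ≫
      m.inv ≫ biprod.map g (biprod.snd : P ⊞ Q ⟶ Q) = 0 := by
    rw [Category.assoc, Iso.hom_inv_id_assoc]
    apply biprod.hom_ext' <;> simp [reassoc_of% w]
  have h₀ := exact_of_isos (exact_biprod h (exact_inl_snd P Q)) (Iso.refl _) m (Iso.refl _) w₀
    (by simp) (by simp)
  obtain ⟨Z, f₂, g₂, w₂, ⟨hZ⟩, hnil, h₂⟩ := exists_exact_isNilpotent hF h₀
  have hpd : ∀ {P' : C}, E.IsProjective P' → ∀ n : ℕ, E.pd P' ≤ n := fun hP' n => by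
    rw [pd_le_iff hC, cls_of_isProjective hP', iterate_map_zero]
  obtain ⟨n, hn⟩ := (pd_lt_top_iff _).1 hD
  have hnil' : IsNilpotent (E.toStable.mapEnd Z (f₂ ≫ biprod.fst)) := by
    obtain ⟨k, hk⟩ := hnil
    exact ⟨k, (map_pow (E.toStable.mapEnd Z) _ k).symm.trans
      ((congrArg (E.toStable.mapEnd Z) hk).trans (E.toStable.map_zero Z Z))⟩
  have hZn : E.pd Z ≤ n := pd_le_of_isNilpotent hC n h₂ hP hnil'
    ((pd_le_biprod_iff hC _ _ _).2 ⟨hn, hpd hQ n⟩)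
  obtain ⟨P₁, Q₁, hP₁, hQ₁, ⟨e₁⟩⟩ := hW
  have hret : Retract (X ⊞ P) (W ⊞ (Q₁ ⊞ P)) := .trans
    ⟨biprod.map (biprod.inl ≫ biprod.inl ≫ e₁.hom) (𝟙 P),
      biprod.map (e₁.inv ≫ biprod.fst ≫ biprod.fst) (𝟙 P),
      by apply biprod.hom_ext' <;> apply biprod.hom_ext <;> simp⟩
    (Retract.ofIso (biprod.associator W Q₁ P))
  obtain ⟨Z₁, Z₂, hZ₁, hZ₂, ⟨e₂⟩⟩ :=
    exists_iso_biprod_of_retract hC (hQ₁.biprod hP) Z ⟨hZ.trans hret⟩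
  have hcls : E.cls Z = E.cls Z₁ := by
    rw [cls_eq_of_iso e₂, cls_biprod, cls_of_isProjective hZ₂, add_zero]
  have hZ₁fin : E.pd Z₁ < ⊤ := (pd_lt_top_iff _).2 ⟨n, by rwa [pd_le_iff hC, ← hcls, ← pd_le_iff hC]⟩
  -- `toNat` loses nothing here, as the finitistic dimension of `add W` is finite
  set N := (E.fpd (addClosure W)).toNat with hN
  have hZ₁N : E.pd Z₁ ≤ N := by
    rw [hN, ENat.natCast_toNat (fpd_addClosure_lt_top E hC W).ne]
    exact le_iSup₂ (f := fun (M : C) (_ : M ∈ {M : C | M ∈ addClosure W ∧ E.pd M < ⊤}) => E.pd M)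
      Z₁ ⟨hZ₁, hZ₁fin⟩
  have hZN : E.pd Z ≤ N := by rwa [pd_le_iff hC, hcls, ← pd_le_iff hC]
  exact ((pd_le_biprod_iff hC _ _ _).1 (pd_le_succ_of_exact hC N h₂ hZN
    ((pd_le_biprod_iff hC _ _ _).2 ⟨hZN, hpd hP N⟩))).1

end IgusaTodorovBound

end ExactStructure

theorem theorem2 {C : Type u} [Category.{v} C] [Preadditive C] [HasFiniteBiproducts C]
    (E : ExactStructure C) [E.IsStrongITContext] {A B D : C} (i : A ⟶ B) (p : B ⟶ D)
    (w : i ≫ p = 0) (hE : E.exact (ShortComplex.mk i p w)) (hD : E.pd D < ⊤) :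
    E.pd D ≤ (E.Psi (A ⊞ B) : ℕ∞) + 1 := by
  have hC : IsKrullSchmidt C := ExactStructure.IsStrongITContext.krullSchmidt (E := E)
  have hF : HasFittingProperty C := ExactStructure.IsStrongITContext.fitting (E := E)
  have hAB := ExactStructure.omega_iterate_phi_eq hC hE hD
  set k := E.Phi (A ⊞ B) with hk
  obtain ⟨X, Y, Z, f, g, w', hfg, hX, hY, hZ⟩ := ExactStructure.exists_exact_iterate hE k
  have hXY : E.StablyIso X Y := ExactStructure.stablyIso_of_cls_eq hC (by rw [hX, hY, hAB])
  have hW : E.StablyIso (X ⊞ Y) (E.iteratedSyzygy (A ⊞ B) k) :=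
    ExactStructure.stablyIso_of_cls_eq hC (by
      rw [ExactStructure.cls_iteratedSyzygy, ExactStructure.cls_biprod,
        ExactStructure.cls_biprod, iterate_map_add, hX, hY])
  -- the projective dimensions of `D` and `Z` differ by at most `k`, since `Z` represents `Ω^k D`
  have hDZ : ∀ n : ℕ, E.pd Z ≤ n ↔ E.pd D ≤ (n + k : ℕ) := fun n => by
    rw [ExactStructure.pd_le_iff hC, ExactStructure.pd_le_iff hC, hZ, Function.iterate_add_apply]
  have hZfin : E.pd Z < ⊤ := by
    obtain ⟨n, hn⟩ := (ExactStructure.pd_lt_top_iff _).1 hD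
    exact (ExactStructure.pd_lt_top_iff _).2
      ⟨n, (hDZ n).2 (hn.trans (Nat.cast_le.2 (Nat.le_add_right n k)))⟩
  have hmain := (hDZ _).1 (ExactStructure.pd_le_of_stablyIso hC hF hfg hXY hW hZfin)
  refine hmain.trans (le_of_eq ?_)
  rw [ExactStructure.Psi, ← hk]
  push_cast
  ring
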